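/- Theorem 6.10. Let $(M^n,g)$ be a smooth Riemannian manifold without boundary, let $m\in\mathbb{R}\cup\{\pm\infty\}$ with $m+n\neq 1,2$, let $\mu\in\mathbb{R}$, and let $f\in C^\infty(M)$. Suppose that the smooth metric measure space $(M^n,g,1^m\,\mathrm{dvol})$ with characteristic constant $\mu$ admits the quasi-Einstein scale $u=e^{f/(m+n-2)}$. For finite $m$ this means that there is a constant $\lambda\in\mathbb{R}$ such that, with $v=1$, \begin{align*} 0&=\big(uv\,\mathrm{Ric}+(m+n-2)v\nabla^2u-mu\nabla^2v\big)_0,\\ n\lambda v^2&=(uv)^2R+(m+2n-2)uv^2\Delta u-mu^2v\Delta v-(m+n-1)n v^2|\nabla u|^2+mn\,uv\langle\nabla u,\nabla v\rangle,\\ n\mu u^2&=(uv)^2R+(m+n-2)uv^2\Delta u-(m-n)u^2v\Delta v-(m+n-2)n\,uv\langle\nabla u,\nabla v\rangle+(m-1)n\,u^2|\nabla v|^2, \end{align*} where $T_0=T-\frac1n(\mathrm{tr}_g T)g$; for $m=\pm\infty$ it means $\mathrm{Ric}+\nabla^2f=\mu g$. Let $$A=\mathrm{Rm}-P\wedge g,\qquad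 P=\frac{1}{m+n-2}\Big(\mathrm{Ric}-\frac{R+m\mu}{2(m+n-1)}g\Big),$$ with $P=0$ for $m=\pm\infty$, be the weighted Weyl curvature, where $(h\wedge k)(x,y,z,w)=h(x,z)k(y,w)+h(y,w)k(x,z)-h(x,w)k(y,z)-h(y,z)k(x,w)$ and $\mathrm{Rm}(x,y,z,w)=\langle-\nabla_x\nabla_yz+\nabla_y\nabla_xz+\nabla_{[x,y]}z,w\rangle$, $\mathrm{Ric}(x,z)=\sum_i\mathrm{Rm}(e_i,x,e_i,z)$. Then $$\delta A=\frac{m+n-3}{m+n-2}\,\iota_{\nabla f}A,$$ i.e. $\sum_i(\nabla_{e_i}A)(e_i,y,z,w)=\frac{m+n-3}{m+n-2}A(\nabla f,y,z,w)$ for all tangent vectors $y,z,w$ and any orthonormal basis $(e_i)$, where the factor $\frac{m+n-3}{m+n-2}$ is read as $1$ when $m=\pm\infty$. -/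

import Mathlib

open scoped Manifold ContDiff

noncomputable section

namespace SMMS

/-! ### Tensor calculus on an open subset of `ℝⁿ`

`G` is the matrix of components of a Riemannian metric as a function of the coordinates.  Tensors
are given by their (covariant) components. -/

section Coordinates

variable {n : ℕ}

/-- The partial derivative `∂ᵢ F`. -/
def pd (i : Fin n) (F : EuclideanSpace ℝ (Fin n) → ℝ) (x : EuclideanSpace ℝ (Fin n)) : ℝ :=
  fderiv ℝ F x (EuclideanSpace.single i 1)

variable (G : EuclideanSpace ℝ (Fin n) → Matrix (Fin n) (Fin n) ℝ)

/-- The Christoffel symbol `Γᵏᵢⱼ` of the Levi-Civita connection: `∇ᵢ ∂ⱼ = Γᵏᵢⱼ ∂ₖ`. -/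
def christoffel (k i j : Fin n) (x : EuclideanSpace ℝ (Fin n)) : ℝ :=
  (1 / 2) * ∑ l, (G x)⁻¹ k l *
    (pd i (fun y => G y j l) x + pd j (fun y => G y i l) x - pd l (fun y => G y i j) x)

/-- The component of index `q` of the vector `∇ᵢ ∇ⱼ ∂ₖ`. -/
def secondCov (i j k q : Fin n) (x : EuclideanSpace ℝ (Fin n)) : ℝ :=
  pd i (christoffel G q j k) x + ∑ p, christoffel G p j k x * christoffel G q i p x

/-- The Riemann curvature tensor `Rm(x,y,u,v) = ⟨-∇ₓ∇ᵧu + ∇ᵧ∇ₓu, v⟩` on coordinate vector fields;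
`Rm(x,y,x,y)` is the sectional curvature for orthonormal `x, y`. -/
def riemann (i j k l : Fin n) (x : EuclideanSpace ℝ (Fin n)) : ℝ :=
  ∑ q, (-secondCov G i j k q x + secondCov G j i k q x) * G x q l

/-- The trace of a `(0,2)`-tensor. -/
def trace (T : Fin n → Fin n → EuclideanSpace ℝ (Fin n) → ℝ) (x : EuclideanSpace ℝ (Fin n)) : ℝ :=
  ∑ i, ∑ j, (G x)⁻¹ i j * T i j x

/-- The tracefree part `T₀ = T - (1/n) (tr T) g` of a `(0,2)`-tensor. -/
def tracefree (T : Fin n → Fin n → EuclideanSpace ℝ (Fin n) → ℝ) (i j : Fin n)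
    (x : EuclideanSpace ℝ (Fin n)) : ℝ :=
  T i j x - (1 / (n : ℝ)) * trace G T x * G x i j

/-- The Ricci tensor `Ric(x,u) = ∑ Rm(eᵢ,x,eᵢ,u)`. -/
def ricci (j l : Fin n) (x : EuclideanSpace ℝ (Fin n)) : ℝ :=
  ∑ i, ∑ k, (G x)⁻¹ i k * riemann G i j k l x

/-- The scalar curvature. -/
def scalar (x : EuclideanSpace ℝ (Fin n)) : ℝ := trace G (ricci G) x

/-- The Hessian `∇² F`. -/
def hess (F : EuclideanSpace ℝ (Fin n) → ℝ) (i j : Fin n) (x : EuclideanSpace ℝ (Fin n)) : ℝ :=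
  pd i (pd j F) x - ∑ k, christoffel G k i j x * pd k F x

/-- The Laplacian `Δ F = tr ∇² F`. -/
def laplacian (F : EuclideanSpace ℝ (Fin n) → ℝ) (x : EuclideanSpace ℝ (Fin n)) : ℝ :=
  trace G (hess G F) x

/-- The components `(∇F)ⁱ` of the gradient. -/
def grad (F : EuclideanSpace ℝ (Fin n) → ℝ) (i : Fin n) (x : EuclideanSpace ℝ (Fin n)) : ℝ :=
  ∑ j, (G x)⁻¹ i j * pd j F x

/-- The inner product `⟨∇F, ∇H⟩`. -/
def gradInner (F H : EuclideanSpace ℝ (Fin n) → ℝ) (x : EuclideanSpace ℝ (Fin n)) : ℝ :=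
  ∑ i, ∑ j, (G x)⁻¹ i j * pd i F x * pd j H x

/-- The Kulkarni-Nomizu product `h ∧ g` of a `(0,2)`-tensor with the metric. -/
def kulkarniNomizu (h : Fin n → Fin n → EuclideanSpace ℝ (Fin n) → ℝ) (i j k l : Fin n)
    (x : EuclideanSpace ℝ (Fin n)) : ℝ :=
  h i k x * G x j l + h j l x * G x i k - h i l x * G x j k - h j k x * G x i l

/-- The covariant derivative `(∇ₚ A)ᵢⱼₖₗ` of a `(0,4)`-tensor. -/
def cov4 (A : Fin n → Fin n → Fin n → Fin n → EuclideanSpace ℝ (Fin n) → ℝ)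
    (p i j k l : Fin n) (x : EuclideanSpace ℝ (Fin n)) : ℝ :=
  pd p (A i j k l) x
    - ∑ s, christoffel G s p i x * A s j k l x - ∑ s, christoffel G s p j x * A i s k l x
    - ∑ s, christoffel G s p k x * A i j s l x - ∑ s, christoffel G s p l x * A i j k s x

/-- The divergence `(δA)(y,u,v) = ∑ (∇_{eᵢ} A)(eᵢ,y,u,v)` of a `(0,4)`-tensor. -/
def div4 (A : Fin n → Fin n → Fin n → Fin n → EuclideanSpace ℝ (Fin n) → ℝ)
    (j k l : Fin n) (x : EuclideanSpace ℝ (Fin n)) : ℝ :=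
  ∑ p, ∑ q, (G x)⁻¹ p q * cov4 G A p q j k l x

/-- The contraction `(ι_{∇F} A)(y,u,v) = A(∇F,y,u,v)` in the first slot. -/
def contractGrad (F : EuclideanSpace ℝ (Fin n) → ℝ)
    (A : Fin n → Fin n → Fin n → Fin n → EuclideanSpace ℝ (Fin n) → ℝ)
    (j k l : Fin n) (x : EuclideanSpace ℝ (Fin n)) : ℝ :=
  ∑ i, grad G F i x * A i j k l x

/-- The tensor `P = (Ric - (R + mμ) / (2(m+n-1)) g) / (m+n-2)` for a finite dimensional parameter
`m`, and its limit `P = 0` for `m = ±∞`. -/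
def weightedSchouten (m : EReal) (μ : ℝ) (i j : Fin n) (x : EuclideanSpace ℝ (Fin n)) : ℝ :=
  if m = ⊤ ∨ m = ⊥ then 0
  else 1 / (m.toReal + n - 2) *
    (ricci G i j x - (scalar G x + m.toReal * μ) / (2 * (m.toReal + n - 1)) * G x i j)

/-- The weighted Weyl curvature `A = Rm - P ∧ g`. -/
def weightedWeyl (m : EReal) (μ : ℝ) (i j k l : Fin n) (x : EuclideanSpace ℝ (Fin n)) : ℝ :=
  riemann G i j k l x - kulkarniNomizu G (weightedSchouten G m μ) i j k l x

/-- The system of equations for a quasi-Einstein scale `u` on `(M, g, v^m dvol)`, `m` finite, with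
characteristic constant `μ` and quasi-Einstein constant `lam`, at the point `x`. -/
structure QESystem (u v : EuclideanSpace ℝ (Fin n) → ℝ) (m lam μ : ℝ)
    (x : EuclideanSpace ℝ (Fin n)) : Prop where
  tracefree_eq : ∀ i j, tracefree G (fun i j y => u y * v y * ricci G i j y
    + (m + n - 2) * v y * hess G u i j y - m * u y * hess G v i j y) i j x = 0
  lam_eq : n * lam * v x ^ 2 = (u x * v x) ^ 2 * scalar G x
    + (m + 2 * n - 2) * u x * v x ^ 2 * laplacian G u x - m * u x ^ 2 * v x * laplacian G v x
    - (m + n - 1) * n * v x ^ 2 * gradInner G u u x + m * n * u x * v x * gradInner G u v x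
  mu_eq : n * μ * u x ^ 2 = (u x * v x) ^ 2 * scalar G x
    + (m + n - 2) * u x * v x ^ 2 * laplacian G u x - (m - n) * u x ^ 2 * v x * laplacian G v x
    - (m + n - 2) * n * u x * v x * gradInner G u v x
    + (m - 1) * n * u x ^ 2 * gradInner G v v x

end Coordinates

/-! ### Riemannian manifolds -/

section Manifold

variable {n : ℕ} {M : Type*} [TopologicalSpace M] [ChartedSpace (EuclideanSpace ℝ (Fin n)) M]
  [IsManifold (𝓡 n) ∞ M]

/-- The components `gᵢⱼ = g(∂ᵢ, ∂ⱼ)` of a Riemannian metric in the chart `e`, as functions on the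
target of `e`; the coordinate vector field `∂ᵢ` is the image of the `i`-th standard basis vector
under the differential of `e⁻¹`. -/
def chartMetric
    (g : Bundle.ContMDiffRiemannianMetric (𝓡 n) ∞ (EuclideanSpace ℝ (Fin n))
      (fun p : M => TangentSpace (𝓡 n) p))
    (e : OpenPartialHomeomorph M (EuclideanSpace ℝ (Fin n))) (x : EuclideanSpace ℝ (Fin n)) :
    Matrix (Fin n) (Fin n) ℝ :=
  Matrix.of fun i j => g.inner (e.symm x)
    (mfderiv 𝓘(ℝ, EuclideanSpace ℝ (Fin n)) (𝓡 n) e.symm x (EuclideanSpace.single i (1 : ℝ)))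
    (mfderiv 𝓘(ℝ, EuclideanSpace ℝ (Fin n)) (𝓡 n) e.symm x (EuclideanSpace.single j (1 : ℝ)))

/-- The function `u` is a quasi-Einstein scale for the smooth metric measure space
`(M, g, v^m dvol)`, `m` finite, with characteristic constant `μ`. -/
def IsQuasiEinsteinScale
    (g : Bundle.ContMDiffRiemannianMetric (𝓡 n) ∞ (EuclideanSpace ℝ (Fin n))
      (fun p : M => TangentSpace (𝓡 n) p))
    (v : M → ℝ) (m μ : ℝ) (u : M → ℝ) : Prop :=
  ∃ lam : ℝ, ∀ e ∈ IsManifold.maximalAtlas (𝓡 n) ∞ M, ∀ x ∈ e.target,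
    QESystem (chartMetric g e) (u ∘ e.symm) (v ∘ e.symm) m lam μ x

/-- `(M, g, 1^m dvol)` with characteristic constant `μ` admits the quasi-Einstein scale
`u = e^{f/(m+n-2)}`.  For `m = ±∞` the scale `u` is only a formal symbol: a conformal change is a
change of measure and the characteristic constant is the quasi-Einstein constant, so the condition
is that `(M, g, e^{-f} dvol)` is quasi-Einstein with constant `μ`, i.e. `Ric + ∇² f = μ g`. -/
def AdmitsScale
    (g : Bundle.ContMDiffRiemannianMetric (𝓡 n) ∞ (EuclideanSpace ℝ (Fin n))
      (fun p : M => TangentSpace (𝓡 n) p))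
    (m : EReal) (μ : ℝ) (f : M → ℝ) : Prop :=
  if m = ⊤ ∨ m = ⊥ then
    ∀ e ∈ IsManifold.maximalAtlas (𝓡 n) ∞ M, ∀ x ∈ e.target, ∀ i j,
      ricci (chartMetric g e) i j x + hess (chartMetric g e) (f ∘ e.symm) i j x
        = μ * chartMetric g e x i j
  else
    IsQuasiEinsteinScale g (fun _ => 1) m.toReal μ
      (fun p => Real.exp (f p / (m.toReal + n - 2)))

/-- The constant `(m+n-3)/(m+n-2)`, which is `1` in the limit `m = ±∞`. -/
def divFactor (n : ℕ) (m : EReal) : ℝ :=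
  if m = ⊤ ∨ m = ⊥ then 1 else (m.toReal + n - 3) / (m.toReal + n - 2)

end Manifold

end SMMS

end

noncomputable section

namespace SMMS

open scoped Matrix

/-! ### Partial derivatives of smooth functions on an open set. -/

section Calculus

variable {n : ℕ} {U : Set (EuclideanSpace ℝ (Fin n))}
  {F H : EuclideanSpace ℝ (Fin n) → ℝ} {x : EuclideanSpace ℝ (Fin n)}

/-! Write `τ = m + n - 2`, so `u = exp (f / τ)`. For finite `m` and `v = 1`, the tracefree and `μ`
equations combine to `Ric = μ g - ∇²f - (1/τ) df ⊗ df` (`QESystem.ricci_eq`). The `λ` equation, with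
`Δf` eliminated, expresses `R` through `|∇f|²` and `exp (-2f/τ)` (`QESystem.scalar_eq`);
differentiating it and using it again to remove `λ` gives `dR` in terms of `Ric(∇f, ·)`, `R df` and
`μ df` (`pd_scalar_of_QESystem`).

By the second Bianchi identity, `δRm` is the antisymmetrized `∇Ric` (`div4_riemann`). Inserting the
formula for `Ric`, the third derivatives of `f` turn into `ι_{∇f} Rm` by the Ricci identity
(`cov2_hess_sub`), up to a term `∇²f ∧ df` with coefficient `1/τ` (`div4_riemann_of_ricci_eq`). The
divergence of `P ∧ g` contains the antisymmetrized `∇P`, hence `(1/τ) δRm`; this is the source of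
the factor `1 - 1/τ`. The remaining terms involve only `Ric`, `R`, `df`, `g` and `dR`, and cancel by
the formula for `dR` (`div4_weightedWeyl`). For `m = ±∞` one has `A = Rm`, and only the Ricci
identity argument is needed.

All of this is done in components in a chart. The connection and its curvature are handled as
matrices, so that curvature symmetries and Bianchi identities become noncommutative polynomial
identities. -/

theorem differentiableAt_of_smoothOn (hU : IsOpen U) (hF : ContDiffOn ℝ ∞ F U) (hx : x ∈ U) :
    DifferentiableAt ℝ F x :=
  (hF.contDiffAt (hU.mem_nhds hx)).differentiableAt (by simp)

theorem pd_congr (hU : IsOpen U) (hx : x ∈ U) (h : ∀ y ∈ U, F y = H y) (i : Fin n) :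
    pd i F x = pd i H x := by
  unfold pd
  rw [Filter.EventuallyEq.fderiv_eq (Filter.eventuallyEq_of_mem (hU.mem_nhds hx) h)]

theorem pd_add (hU : IsOpen U) (hF : ContDiffOn ℝ ∞ F U) (hH : ContDiffOn ℝ ∞ H U) (hx : x ∈ U)
    (i : Fin n) : pd i (fun y => F y + H y) x = pd i F x + pd i H x := by
  unfold pd
  rw [fderiv_fun_add (differentiableAt_of_smoothOn hU hF hx)
    (differentiableAt_of_smoothOn hU hH hx)]
  rfl

theorem pd_sub (hU : IsOpen U) (hF : ContDiffOn ℝ ∞ F U) (hH : ContDiffOn ℝ ∞ H U) (hx : x ∈ U)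
    (i : Fin n) : pd i (fun y => F y - H y) x = pd i F x - pd i H x := by
  unfold pd
  rw [fderiv_fun_sub (differentiableAt_of_smoothOn hU hF hx)
    (differentiableAt_of_smoothOn hU hH hx)]
  rfl

theorem pd_neg (i : Fin n) : pd i (fun y => -F y) x = -pd i F x := by
  unfold pd
  rw [fderiv_fun_neg]
  rfl

theorem pd_const (c : ℝ) (i : Fin n) : pd i (fun _ => c) x = 0 := by
  simp [pd]

theorem pd_mul (hU : IsOpen U) (hF : ContDiffOn ℝ ∞ F U) (hH : ContDiffOn ℝ ∞ H U) (hx : x ∈ U)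
    (i : Fin n) : pd i (fun y => F y * H y) x = pd i F x * H x + F x * pd i H x := by
  unfold pd
  rw [fderiv_fun_mul (differentiableAt_of_smoothOn hU hF hx)
    (differentiableAt_of_smoothOn hU hH hx)]
  simp
  ring

theorem pd_const_mul (hU : IsOpen U) (c : ℝ) (hF : ContDiffOn ℝ ∞ F U) (hx : x ∈ U) (i : Fin n) :
    pd i (fun y => c * F y) x = c * pd i F x := by
  rw [pd_mul hU contDiffOn_const hF hx, pd_const, zero_mul, zero_add]

theorem pd_sum {ι : Type*} (s : Finset ι) {K : ι → EuclideanSpace ℝ (Fin n) → ℝ} (hU : IsOpen U)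
    (hK : ∀ a, ContDiffOn ℝ ∞ (K a) U) (hx : x ∈ U) (i : Fin n) :
    pd i (fun y => ∑ a ∈ s, K a y) x = ∑ a ∈ s, pd i (K a) x := by
  unfold pd
  rw [fderiv_fun_sum fun a _ => differentiableAt_of_smoothOn hU (hK a) hx]
  simp

theorem pd_exp (hU : IsOpen U) (hF : ContDiffOn ℝ ∞ F U) (hx : x ∈ U) (i : Fin n) :
    pd i (fun y => Real.exp (F y)) x = Real.exp (F x) * pd i F x := by
  unfold pd
  rw [fderiv_exp (differentiableAt_of_smoothOn hU hF hx)]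
  simp

theorem smoothOn_pd (hU : IsOpen U) (hF : ContDiffOn ℝ ∞ F U) (i : Fin n) :
    ContDiffOn ℝ ∞ (pd i F) U :=
  (hF.fderiv_of_isOpen hU (by simp)).clm_apply contDiffOn_const

theorem pd_comm (hU : IsOpen U) (hF : ContDiffOn ℝ ∞ F U) (hx : x ∈ U) (i j : Fin n) :
    pd i (pd j F) x = pd j (pd i F) x := by
  have hd : DifferentiableAt ℝ (fderiv ℝ F) x :=
    ((hF.fderiv_of_isOpen (m := ∞) hU (by simp)).contDiffAt (hU.mem_nhds hx)).differentiableAt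
      (by simp)
  have key : ∀ a b : Fin n, pd a (pd b F) x = fderiv ℝ (fderiv ℝ F) x
      (EuclideanSpace.single a 1) (EuclideanSpace.single b 1) := by
    intro a b
    unfold pd
    rw [fderiv_clm_apply hd (differentiableAt_const _)]
    simp
  rw [key, key]
  exact ((hF.contDiffAt (hU.mem_nhds hx)).isSymmSndFDerivAt
    (by simpa using WithTop.coe_le_coe.2 (le_top : (2 : ℕ∞) ≤ ⊤))) _ _

end Calculus

/-! ### Entrywise calculus of matrix-valued functions. -/

section MatrixCalculus

variable {n : ℕ} {U : Set (EuclideanSpace ℝ (Fin n))}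
  {A B : EuclideanSpace ℝ (Fin n) → Matrix (Fin n) (Fin n) ℝ}
  {a b : EuclideanSpace ℝ (Fin n) → Fin n → ℝ} {x : EuclideanSpace ℝ (Fin n)}

/-- All entries of a matrix-valued function are smooth on `U`. -/
def SmoothEntries (A : EuclideanSpace ℝ (Fin n) → Matrix (Fin n) (Fin n) ℝ)
    (U : Set (EuclideanSpace ℝ (Fin n))) : Prop :=
  ∀ i j, ContDiffOn ℝ ∞ (fun y => A y i j) U

/-- The entrywise partial derivative of a matrix-valued function. -/
def pdMatrix (p : Fin n) (A : EuclideanSpace ℝ (Fin n) → Matrix (Fin n) (Fin n) ℝ)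
    (x : EuclideanSpace ℝ (Fin n)) : Matrix (Fin n) (Fin n) ℝ :=
  Matrix.of fun i j => pd p (fun y => A y i j) x

theorem SmoothEntries.add (hA : SmoothEntries A U) (hB : SmoothEntries B U) :
    SmoothEntries (fun y => A y + B y) U := fun i j => (hA i j).add (hB i j)

theorem SmoothEntries.sub (hA : SmoothEntries A U) (hB : SmoothEntries B U) :
    SmoothEntries (fun y => A y - B y) U := fun i j => (hA i j).sub (hB i j)

theorem SmoothEntries.neg (hA : SmoothEntries A U) :
    SmoothEntries (fun y => -A y) U := fun i j => (hA i j).neg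

theorem SmoothEntries.transpose (hA : SmoothEntries A U) :
    SmoothEntries (fun y => (A y)ᵀ) U := fun i j => hA j i

theorem SmoothEntries.mul (hA : SmoothEntries A U) (hB : SmoothEntries B U) :
    SmoothEntries (fun y => A y * B y) U := by
  intro i j
  simp only [Matrix.mul_apply]
  exact ContDiffOn.sum fun k _ => (hA i k).mul (hB k j)

theorem SmoothEntries.pdMatrix (hU : IsOpen U) (hA : SmoothEntries A U) (p : Fin n) :
    SmoothEntries (pdMatrix p A) U := fun i j => smoothOn_pd hU (hA i j) p

theorem SmoothEntries.det (hA : SmoothEntries A U) : ContDiffOn ℝ ∞ (fun y => (A y).det) U := by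
  simp only [Matrix.det_apply]
  refine ContDiffOn.sum fun σ _ => ContDiffOn.const_smul _ ?_
  exact contDiffOn_prod fun i _ => hA (σ i) i

/-- Cramer's rule: each entry is `det⁻¹` times the determinant of `A` with one row replaced by a
constant row. -/
theorem SmoothEntries.inv (hA : SmoothEntries A U) (hdet : ∀ y ∈ U, IsUnit (A y).det) :
    SmoothEntries (fun y => (A y)⁻¹) U := by
  intro i j
  simp only [Matrix.inv_def, Matrix.smul_apply, Matrix.adjugate_apply, Ring.inverse_eq_inv',
    smul_eq_mul]
  refine (hA.det.inv fun y hy => (hdet y hy).ne_zero).mul (SmoothEntries.det ?_)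
  intro k l
  simp only [Matrix.updateRow_apply]
  by_cases hk : k = j
  · simpa [hk] using contDiffOn_const
  · simpa [hk] using hA k l

theorem pdMatrix_congr (hU : IsOpen U) (hx : x ∈ U) (h : ∀ y ∈ U, A y = B y) (p : Fin n) :
    pdMatrix p A x = pdMatrix p B x := by
  ext i j
  exact pd_congr hU hx (fun y hy => by rw [h y hy]) p

theorem pdMatrix_add (hU : IsOpen U) (hA : SmoothEntries A U) (hB : SmoothEntries B U)
    (hx : x ∈ U) (p : Fin n) :
    pdMatrix p (fun y => A y + B y) x = pdMatrix p A x + pdMatrix p B x := by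
  ext i j
  exact pd_add hU (hA i j) (hB i j) hx p

theorem pdMatrix_sub (hU : IsOpen U) (hA : SmoothEntries A U) (hB : SmoothEntries B U)
    (hx : x ∈ U) (p : Fin n) :
    pdMatrix p (fun y => A y - B y) x = pdMatrix p A x - pdMatrix p B x := by
  ext i j
  exact pd_sub hU (hA i j) (hB i j) hx p

theorem pdMatrix_neg (p : Fin n) :
    pdMatrix p (fun y => -A y) x = -pdMatrix p A x := by
  ext i j
  exact pd_neg p

theorem pdMatrix_transpose (p : Fin n) :
    pdMatrix p (fun y => (A y)ᵀ) x = (pdMatrix p A x)ᵀ := rfl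

theorem pdMatrix_const (C : Matrix (Fin n) (Fin n) ℝ) (p : Fin n) :
    pdMatrix p (fun _ => C) x = 0 := by
  ext i j
  exact pd_const _ p

theorem pdMatrix_mul (hU : IsOpen U) (hA : SmoothEntries A U) (hB : SmoothEntries B U)
    (hx : x ∈ U) (p : Fin n) :
    pdMatrix p (fun y => A y * B y) x = pdMatrix p A x * B x + A x * pdMatrix p B x := by
  ext i j
  simp only [pdMatrix, Matrix.of_apply, Matrix.mul_apply, Matrix.add_apply]
  rw [pd_sum _ hU (fun k => (hA i k).mul (hB k j)) hx, ← Finset.sum_add_distrib]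
  exact Finset.sum_congr rfl fun k _ => pd_mul hU (hA i k) (hB k j) hx p

theorem pdMatrix_comm (hU : IsOpen U) (hA : SmoothEntries A U) (hx : x ∈ U) (p q : Fin n) :
    pdMatrix p (pdMatrix q A) x = pdMatrix q (pdMatrix p A) x := by
  ext i j
  exact pd_comm hU (hA i j) hx p q

end MatrixCalculus

/-! ### The Levi-Civita connection and its curvature in matrix form. -/

section Geometry

variable {n : ℕ} {U : Set (EuclideanSpace ℝ (Fin n))}
  {G : EuclideanSpace ℝ (Fin n) → Matrix (Fin n) (Fin n) ℝ} {x : EuclideanSpace ℝ (Fin n)}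

/-- `G` is the component matrix of a smooth nondegenerate symmetric bilinear form on the open
set `U`. -/
structure IsMetricOn (G : EuclideanSpace ℝ (Fin n) → Matrix (Fin n) (Fin n) ℝ)
    (U : Set (EuclideanSpace ℝ (Fin n))) : Prop where
  isOpen : IsOpen U
  smooth : SmoothEntries G U
  symm : ∀ y, (G y)ᵀ = G y
  isUnit_det : ∀ y ∈ U, IsUnit (G y).det

/-- The matrix of the connection in the direction `∂ₚ`. -/
def connMatrix (G : EuclideanSpace ℝ (Fin n) → Matrix (Fin n) (Fin n) ℝ) (p : Fin n)
    (x : EuclideanSpace ℝ (Fin n)) : Matrix (Fin n) (Fin n) ℝ :=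
  Matrix.of fun q k => christoffel G q p k x

/-- The matrix of `∇ᵢ ∇ⱼ` on coordinate vector fields. -/
def secondCovMatrix (G : EuclideanSpace ℝ (Fin n) → Matrix (Fin n) (Fin n) ℝ) (i j : Fin n)
    (x : EuclideanSpace ℝ (Fin n)) : Matrix (Fin n) (Fin n) ℝ :=
  pdMatrix i (connMatrix G j) x + connMatrix G i x * connMatrix G j x

/-- The curvature endomorphism of the connection. -/
def curvMatrix (G : EuclideanSpace ℝ (Fin n) → Matrix (Fin n) (Fin n) ℝ) (i j : Fin n)
    (x : EuclideanSpace ℝ (Fin n)) : Matrix (Fin n) (Fin n) ℝ :=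
  secondCovMatrix G i j x - secondCovMatrix G j i x

/-- The covariant derivative `(∇ₚ T)ᵢⱼ` of a `(0,2)`-tensor. -/
def cov2 (G : EuclideanSpace ℝ (Fin n) → Matrix (Fin n) (Fin n) ℝ)
    (T : Fin n → Fin n → EuclideanSpace ℝ (Fin n) → ℝ)
    (p i j : Fin n) (x : EuclideanSpace ℝ (Fin n)) : ℝ :=
  pd p (T i j) x
    - ∑ s, christoffel G s p i x * T s j x - ∑ s, christoffel G s p j x * T i s x

theorem cov2_eq_matrix (A : EuclideanSpace ℝ (Fin n) → Matrix (Fin n) (Fin n) ℝ)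
    (p i j : Fin n) :
    cov2 G (fun i j y => A y i j) p i j x =
      (pdMatrix p A x - (connMatrix G p x)ᵀ * A x - A x * connMatrix G p x) i j := by
  simp only [cov2, connMatrix, pdMatrix, Matrix.sub_apply, Matrix.of_apply, Matrix.mul_apply,
    Matrix.transpose_apply, mul_comm]

/-- Torsion-freeness. Since `IsMetricOn` requires symmetry at every point, this needs no `x ∈ U` and
yields an equality of functions, usable under `pd`. -/
theorem christoffel_comm (hG : IsMetricOn G U) (k i j : Fin n) :
    christoffel G k i j x = christoffel G k j i x := by
  have h : (fun y => G y i j) = fun y => G y j i := by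
    funext y
    exact congrFun (congrFun (hG.symm y).symm i) j
  unfold christoffel
  rw [h]
  congr 1
  exact Finset.sum_congr rfl fun l _ => by ring

theorem IsMetricOn.apply_comm (hG : IsMetricOn G U) (y : EuclideanSpace ℝ (Fin n)) (i j : Fin n) :
    G y i j = G y j i := congrFun (congrFun (hG.symm y).symm i) j

theorem IsMetricOn.smooth_inv (hG : IsMetricOn G U) : SmoothEntries (fun y => (G y)⁻¹) U :=
  hG.smooth.inv hG.isUnit_det

theorem IsMetricOn.mul_inv (hG : IsMetricOn G U) (hx : x ∈ U) : G x * (G x)⁻¹ = 1 :=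
  Matrix.mul_nonsing_inv _ (hG.isUnit_det x hx)

theorem IsMetricOn.inv_mul (hG : IsMetricOn G U) (hx : x ∈ U) : (G x)⁻¹ * G x = 1 :=
  Matrix.nonsing_inv_mul _ (hG.isUnit_det x hx)

theorem IsMetricOn.inv_symm (hG : IsMetricOn G U) (y : EuclideanSpace ℝ (Fin n)) :
    ((G y)⁻¹)ᵀ = (G y)⁻¹ := by
  rw [Matrix.transpose_nonsing_inv, hG.symm]

theorem IsMetricOn.inv_apply_comm (hG : IsMetricOn G U) (y : EuclideanSpace ℝ (Fin n))
    (i j : Fin n) : (G y)⁻¹ i j = (G y)⁻¹ j i :=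
  congrFun (congrFun (hG.inv_symm y).symm i) j

theorem smoothEntries_connMatrix (hG : IsMetricOn G U) (p : Fin n) :
    SmoothEntries (connMatrix G p) U := by
  intro q k
  refine contDiffOn_const.mul (ContDiffOn.sum fun l _ => (hG.smooth_inv q l).mul ?_)
  exact ((smoothOn_pd hG.isOpen (hG.smooth _ _) _).add
    (smoothOn_pd hG.isOpen (hG.smooth _ _) _)).sub (smoothOn_pd hG.isOpen (hG.smooth _ _) _)

theorem smoothEntries_secondCovMatrix (hG : IsMetricOn G U) (i j : Fin n) :
    SmoothEntries (secondCovMatrix G i j) U :=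
  ((smoothEntries_connMatrix hG j).pdMatrix hG.isOpen i).add
    ((smoothEntries_connMatrix hG i).mul (smoothEntries_connMatrix hG j))

theorem smoothEntries_curvMatrix (hG : IsMetricOn G U) (i j : Fin n) :
    SmoothEntries (curvMatrix G i j) U :=
  (smoothEntries_secondCovMatrix hG i j).sub (smoothEntries_secondCovMatrix hG j i)

/-- The Christoffel symbols of the first kind. -/
theorem metric_mul_connMatrix (hG : IsMetricOn G U) (hx : x ∈ U) (p i j : Fin n) :
    (G x * connMatrix G p x) j i = (1 / 2) * (pd p (fun y => G y i j) x
      + pd i (fun y => G y p j) x - pd j (fun y => G y p i) x) := by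
  have h : connMatrix G p x = (G x)⁻¹ * Matrix.of fun l i => (1 / 2) *
      (pd p (fun y => G y i l) x + pd i (fun y => G y p l) x - pd l (fun y => G y p i) x) := by
    ext q k
    simp only [connMatrix, christoffel, Matrix.of_apply, Matrix.mul_apply, Finset.mul_sum]
    exact Finset.sum_congr rfl fun l _ => by ring
  rw [h, ← mul_assoc, hG.mul_inv hx, one_mul, Matrix.of_apply]

/-- The Levi-Civita connection is metric. -/
theorem pdMatrix_metric (hG : IsMetricOn G U) (hx : x ∈ U) (p : Fin n) :
    pdMatrix p G x = (connMatrix G p x)ᵀ * G x + G x * connMatrix G p x := by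
  have h : (connMatrix G p x)ᵀ * G x = (G x * connMatrix G p x)ᵀ := by
    rw [Matrix.transpose_mul, hG.symm]
  have hs : ∀ i j, (fun y => G y i j) = fun y => G y j i := fun i j => by
    funext y
    exact hG.apply_comm y i j
  ext i j
  rw [h, Matrix.add_apply, Matrix.transpose_apply, metric_mul_connMatrix hG hx,
    metric_mul_connMatrix hG hx, hs j i]
  simp only [pdMatrix, Matrix.of_apply]
  ring

/-- The inverse metric is parallel: differentiate `G⁻¹ G = 1` and insert metric compatibility. -/
theorem pdMatrix_inv (hG : IsMetricOn G U) (hx : x ∈ U) (p : Fin n) :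
    pdMatrix p (fun y => (G y)⁻¹) x
      = -((G x)⁻¹ * (connMatrix G p x)ᵀ) - connMatrix G p x * (G x)⁻¹ := by
  have h := pdMatrix_mul hG.isOpen hG.smooth_inv hG.smooth hx p
  rw [pdMatrix_congr hG.isOpen hx (fun y hy => hG.inv_mul hy) p, pdMatrix_const,
    pdMatrix_metric hG hx] at h
  have h2 : pdMatrix p (fun y => (G y)⁻¹) x * G x
      = -((G x)⁻¹ * ((connMatrix G p x)ᵀ * G x)) - connMatrix G p x := by
    rw [mul_add, ← mul_assoc (G x)⁻¹ (G x), hG.inv_mul hx, one_mul] at h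
    rw [← sub_eq_zero]
    refine Eq.trans ?_ h.symm
    abel
  calc pdMatrix p (fun y => (G y)⁻¹) x
      = pdMatrix p (fun y => (G y)⁻¹) x * G x * (G x)⁻¹ := by
        rw [mul_assoc, hG.mul_inv hx, mul_one]
    _ = _ := by
        rw [h2, sub_mul, neg_mul, mul_assoc, mul_assoc, hG.mul_inv hx, mul_one]

theorem sum_inv_mul_eq_trace (hG : IsMetricOn G U) (A : Matrix (Fin n) (Fin n) ℝ) :
    ∑ i, ∑ j, (G x)⁻¹ i j * A i j = ((G x)⁻¹ * A).trace := by
  simp only [Matrix.trace, Matrix.diag_apply, Matrix.mul_apply]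
  rw [Finset.sum_comm]
  exact Finset.sum_congr rfl fun i _ => Finset.sum_congr rfl fun j _ => by
    rw [hG.inv_apply_comm]

/-- Covariant differentiation commutes with taking traces. -/
theorem pd_trace (hG : IsMetricOn G U) (hx : x ∈ U)
    {T : Fin n → Fin n → EuclideanSpace ℝ (Fin n) → ℝ}
    (hT : ∀ i j, ContDiffOn ℝ ∞ (T i j) U) (p : Fin n) :
    pd p (trace G T) x = ∑ i, ∑ j, (G x)⁻¹ i j * cov2 G T p i j x := by
  set A : EuclideanSpace ℝ (Fin n) → Matrix (Fin n) (Fin n) ℝ :=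
    fun y => Matrix.of fun i j => T i j y with hAdef
  have hA : SmoothEntries A U := hT
  have hm := hG.smooth_inv.mul hA
  have h1 : trace G T = fun y => ∑ i, ((G y)⁻¹ * A y) i i := by
    funext y
    exact sum_inv_mul_eq_trace hG (A y)
  have h2 : pd p (trace G T) x = (pdMatrix p (fun y => (G y)⁻¹ * A y) x).trace := by
    rw [h1, pd_sum _ hG.isOpen (fun i => hm i i) hx]
    rfl
  have h3 := fun i j => cov2_eq_matrix (G := G) (x := x) A p i j
  change ∀ i j, cov2 G T p i j x = _ at h3
  simp only [h3]
  rw [sum_inv_mul_eq_trace hG, h2, pdMatrix_mul hG.isOpen hG.smooth_inv hA hx,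
    pdMatrix_inv hG hx]
  simp only [sub_mul, mul_sub, neg_mul, Matrix.trace_add, Matrix.trace_sub, Matrix.trace_neg]
  -- Cyclicity of the trace identifies the term where the connection acts on the second index of `T`
  -- with the one coming from `∂G⁻¹`.
  rw [← mul_assoc (G x)⁻¹ (A x), Matrix.trace_mul_comm ((G x)⁻¹ * A x), mul_assoc (G x)⁻¹,
    mul_assoc (connMatrix G p x)]
  ring

/-- Covariant differentiation commutes with the contraction of the first and third slots. -/
theorem cov2_contract (hG : IsMetricOn G U) (hx : x ∈ U)
    {A : Fin n → Fin n → Fin n → Fin n → EuclideanSpace ℝ (Fin n) → ℝ}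
    (hA : ∀ i j k l, ContDiffOn ℝ ∞ (A i j k l) U) (p j l : Fin n) :
    cov2 G (fun j l y => ∑ i, ∑ k, (G y)⁻¹ i k * A i j k l y) p j l x
      = ∑ i, ∑ k, (G x)⁻¹ i k * cov4 G A p i j k l x := by
  -- With `j` and `l` frozen this is the trace of a `(0,2)`-tensor; the Christoffel terms in `j` and
  -- `l` then pass through the contraction by linearity.
  have h := pd_trace hG hx (T := fun i k => A i j k l) (fun i k => hA i j k l) p
  change pd p (fun y => ∑ i, ∑ k, (G y)⁻¹ i k * A i j k l y) x = _ at h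
  unfold cov2 cov4
  rw [h]
  unfold cov2
  have e1 : ∑ s, christoffel G s p j x * ∑ i, ∑ k, (G x)⁻¹ i k * A i s k l x
      = ∑ i, ∑ k, (G x)⁻¹ i k * ∑ s, christoffel G s p j x * A i s k l x := by
    simp only [Finset.mul_sum]
    rw [Finset.sum_comm]
    refine Finset.sum_congr rfl fun i _ => ?_
    rw [Finset.sum_comm]
    exact Finset.sum_congr rfl fun k _ => Finset.sum_congr rfl fun s _ => by ring
  have e2 : ∑ s, christoffel G s p l x * ∑ i, ∑ k, (G x)⁻¹ i k * A i j k s x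
      = ∑ i, ∑ k, (G x)⁻¹ i k * ∑ s, christoffel G s p l x * A i j k s x := by
    simp only [Finset.mul_sum]
    rw [Finset.sum_comm]
    refine Finset.sum_congr rfl fun i _ => ?_
    rw [Finset.sum_comm]
    exact Finset.sum_congr rfl fun k _ => Finset.sum_congr rfl fun s _ => by ring
  rw [e1, e2, ← Finset.sum_sub_distrib, ← Finset.sum_sub_distrib]
  refine Finset.sum_congr rfl fun i _ => ?_
  rw [← Finset.sum_sub_distrib, ← Finset.sum_sub_distrib]
  exact Finset.sum_congr rfl fun k _ => by ring

/-! ### Symmetries of the curvature tensor -/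

theorem secondCov_eq_matrix (i j k q : Fin n) :
    secondCov G i j k q x = secondCovMatrix G i j x q k := by
  simp only [secondCov, secondCovMatrix, pdMatrix, connMatrix, Matrix.add_apply, Matrix.of_apply,
    Matrix.mul_apply, mul_comm]

theorem riemann_eq_matrix (i j k l : Fin n) :
    riemann G i j k l x = (-((curvMatrix G i j x)ᵀ * G x)) k l := by
  simp only [riemann, secondCov_eq_matrix, curvMatrix, Matrix.neg_apply, Matrix.mul_apply,
    Matrix.transpose_apply, Matrix.sub_apply, ← Finset.sum_neg_distrib]
  exact Finset.sum_congr rfl fun q _ => by ring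

theorem smoothOn_riemann (hG : IsMetricOn G U) (i j k l : Fin n) :
    ContDiffOn ℝ ∞ (riemann G i j k l) U := by
  have h : riemann G i j k l = fun y => (-((curvMatrix G i j y)ᵀ * G y)) k l := by
    funext y
    exact riemann_eq_matrix i j k l
  rw [h]
  exact ((smoothEntries_curvMatrix hG i j).transpose.mul hG.smooth).neg k l

theorem riemann_swap_left (i j k l : Fin n) :
    riemann G j i k l x = -riemann G i j k l x := by
  simp only [riemann, ← Finset.sum_neg_distrib]
  exact Finset.sum_congr rfl fun q _ => by ring

/-- Second partials of `G` commute. Applying metric compatibility twice to `∂ₐ∂_b G`, the mixed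
terms `ωᵀ G ω` are symmetric in `a, b` and drop out of the commutator, leaving the curvature. -/
theorem curvMatrix_skew (hG : IsMetricOn G U) (hx : x ∈ U) (i j : Fin n) :
    (curvMatrix G i j x)ᵀ * G x + G x * curvMatrix G i j x = 0 := by
  have key : ∀ a b, pdMatrix a (pdMatrix b G) x
      = (secondCovMatrix G a b x)ᵀ * G x + G x * secondCovMatrix G a b x
        + ((connMatrix G b x)ᵀ * G x * connMatrix G a x
          + (connMatrix G a x)ᵀ * G x * connMatrix G b x) := by
    intro a b
    have hb := smoothEntries_connMatrix hG b
    rw [pdMatrix_congr hG.isOpen hx (fun y hy => pdMatrix_metric hG hy b) a,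
      pdMatrix_add hG.isOpen (hb.transpose.mul hG.smooth) (hG.smooth.mul hb) hx,
      pdMatrix_mul hG.isOpen hb.transpose hG.smooth hx, pdMatrix_mul hG.isOpen hG.smooth hb hx,
      pdMatrix_metric hG hx, pdMatrix_transpose]
    simp only [secondCovMatrix, Matrix.transpose_add, Matrix.transpose_mul]
    noncomm_ring
  have h := pdMatrix_comm hG.isOpen hG.smooth hx i j
  rw [key, key] at h
  simp only [curvMatrix, Matrix.transpose_sub, sub_mul, mul_sub]
  rw [← sub_eq_zero] at h
  refine Eq.trans ?_ h
  abel

theorem riemann_swap_right (hG : IsMetricOn G U) (hx : x ∈ U) (i j k l : Fin n) :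
    riemann G i j l k x = -riemann G i j k l x := by
  have h := congrFun (congrFun (curvMatrix_skew hG hx i j) k) l
  have e : G x * curvMatrix G i j x = ((curvMatrix G i j x)ᵀ * G x)ᵀ := by
    rw [Matrix.transpose_mul, hG.symm, Matrix.transpose_transpose]
  rw [e] at h
  simp only [Matrix.add_apply, Matrix.transpose_apply, Matrix.zero_apply] at h
  simp only [riemann_eq_matrix, Matrix.neg_apply]
  linarith

/-- By torsion-freeness `∇ₐ∇_b ∂_c = ∇ₐ∇_c ∂_b`, so the six second derivatives cancel in pairs. -/
theorem riemann_bianchi (hG : IsMetricOn G U) (i j k l : Fin n) :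
    riemann G i j k l x + riemann G j k i l x + riemann G k i j l x = 0 := by
  have hs : ∀ a b c q, secondCov G a b c q x = secondCov G a c b q x := by
    intro a b c q
    unfold secondCov
    have : christoffel G q b c = christoffel G q c b := by
      funext y
      exact christoffel_comm hG q b c
    rw [this]
    congr 1
    exact Finset.sum_congr rfl fun p _ => by rw [christoffel_comm hG p b c]
  simp only [riemann, ← Finset.sum_add_distrib]
  refine Finset.sum_eq_zero fun q _ => ?_
  rw [hs i j k, hs j i k, hs k j i]
  ring

theorem riemann_pair_symm (hG : IsMetricOn G U) (hx : x ∈ U) (i j k l : Fin n) :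
    riemann G i j k l x = riemann G k l i j x := by
  have b1 := riemann_bianchi (x := x) hG i j k l
  have b2 := riemann_bianchi (x := x) hG j k l i
  have b3 := riemann_bianchi (x := x) hG k l i j
  have b4 := riemann_bianchi (x := x) hG l i j k
  have s := fun a b c d => riemann_swap_left (G := G) (x := x) a b c d
  have r := fun a b c d => riemann_swap_right hG hx a b c d
  -- The usual octahedron argument: four first Bianchi identities, combined modulo the two
  -- antisymmetries.
  linarith [s k i j l, s i k j l, s l j k i, s j l i k, r i j k l, r j k i l, r k i j l,
    r k l i j, r l i j k, r i k l j, r j l i k]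

theorem ricci_comm (hG : IsMetricOn G U) (hx : x ∈ U) (j l : Fin n) :
    ricci G j l x = ricci G l j x := by
  unfold ricci
  rw [Finset.sum_comm]
  exact Finset.sum_congr rfl fun i _ => Finset.sum_congr rfl fun k _ => by
    rw [hG.inv_apply_comm, riemann_pair_symm hG hx]

theorem smoothOn_ricci (hG : IsMetricOn G U) (j l : Fin n) :
    ContDiffOn ℝ ∞ (ricci G j l) U :=
  ContDiffOn.sum fun i _ => ContDiffOn.sum fun k _ =>
    (hG.smooth_inv i k).mul (smoothOn_riemann hG i j k l)

theorem smoothOn_scalar (hG : IsMetricOn G U) : ContDiffOn ℝ ∞ (scalar G) U := by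
  unfold scalar trace
  exact
  ContDiffOn.sum fun i _ => ContDiffOn.sum fun k _ =>
    ContDiffOn.mul (hG.smooth_inv i k) (smoothOn_ricci hG i k)

/-! ### Differential Bianchi identities -/

/-- Metric compatibility absorbs the derivative of `G` and the connection terms of the last two
slots into `∂ₚF + [ωₚ, F]`, where `F` is the curvature matrix. -/
theorem cov4_riemann_eq (hG : IsMetricOn G U) (hx : x ∈ U) (p i j k l : Fin n) :
    cov4 G (riemann G) p i j k l x =
      (-((pdMatrix p (curvMatrix G i j) x + connMatrix G p x * curvMatrix G i j x
        - curvMatrix G i j x * connMatrix G p x)ᵀ * G x)) k l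
      - ∑ s, christoffel G s p i x * riemann G s j k l x
      - ∑ s, christoffel G s p j x * riemann G i s k l x := by
  have hF := smoothEntries_curvMatrix hG i j
  have hR := (hF.transpose.mul hG.smooth).neg
  have h := cov2_eq_matrix (G := G) (x := x)
    (fun y => -((curvMatrix G i j y)ᵀ * G y)) p k l
  have e : (fun k l y => (-((curvMatrix G i j y)ᵀ * G y)) k l) = riemann G i j := by
    funext k l y
    exact (riemann_eq_matrix i j k l).symm
  rw [e, pdMatrix_neg, pdMatrix_mul hG.isOpen hF.transpose hG.smooth hx,
    pdMatrix_metric hG hx, pdMatrix_transpose] at h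
  have e2 : -((pdMatrix p (curvMatrix G i j) x)ᵀ * G x + (curvMatrix G i j x)ᵀ *
      ((connMatrix G p x)ᵀ * G x + G x * connMatrix G p x)) -
      (connMatrix G p x)ᵀ * -((curvMatrix G i j x)ᵀ * G x) -
      -((curvMatrix G i j x)ᵀ * G x) * connMatrix G p x
      = -((pdMatrix p (curvMatrix G i j) x + connMatrix G p x * curvMatrix G i j x
        - curvMatrix G i j x * connMatrix G p x)ᵀ * G x) := by
    simp only [Matrix.transpose_sub, Matrix.transpose_add, Matrix.transpose_mul]
    noncomm_ring
  rw [e2] at h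
  rw [← h]
  unfold cov2 cov4
  ring

/-- This is `d_ω F = 0` for `F = dω + ω ∧ ω`: second partials of `ω` commute, and the rest cancels
as noncommutative polynomials. -/
theorem curvMatrix_bianchi (hG : IsMetricOn G U) (hx : x ∈ U) (p i j : Fin n) :
    (pdMatrix p (curvMatrix G i j) x + connMatrix G p x * curvMatrix G i j x
        - curvMatrix G i j x * connMatrix G p x)
      + (pdMatrix i (curvMatrix G j p) x + connMatrix G i x * curvMatrix G j p x
        - curvMatrix G j p x * connMatrix G i x)
      + (pdMatrix j (curvMatrix G p i) x + connMatrix G j x * curvMatrix G p i x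
        - curvMatrix G p i x * connMatrix G j x) = 0 := by
  have hs := smoothEntries_secondCovMatrix hG
  have hc := smoothEntries_connMatrix hG
  have key : ∀ a b c, pdMatrix a (secondCovMatrix G b c) x
      = pdMatrix a (pdMatrix b (connMatrix G c)) x
        + (pdMatrix a (connMatrix G b) x * connMatrix G c x
        + connMatrix G b x * pdMatrix a (connMatrix G c) x) := by
    intro a b c
    rw [← pdMatrix_mul hG.isOpen (hc b) (hc c) hx]
    exact pdMatrix_add hG.isOpen ((hc c).pdMatrix hG.isOpen b) ((hc b).mul (hc c)) hx a
  have key2 : ∀ a b c, pdMatrix a (curvMatrix G b c) x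
      = pdMatrix a (secondCovMatrix G b c) x - pdMatrix a (secondCovMatrix G c b) x :=
    fun a b c => pdMatrix_sub hG.isOpen (hs b c) (hs c b) hx a
  simp only [key2, key]
  rw [pdMatrix_comm hG.isOpen (hc j) hx p i, pdMatrix_comm hG.isOpen (hc i) hx p j,
    pdMatrix_comm hG.isOpen (hc p) hx i j]
  simp only [curvMatrix, secondCovMatrix]
  noncomm_ring

/-- The second Bianchi identity. -/
theorem cov4_riemann_bianchi (hG : IsMetricOn G U) (hx : x ∈ U) (p i j k l : Fin n) :
    cov4 G (riemann G) p i j k l x + cov4 G (riemann G) i j p k l x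
      + cov4 G (riemann G) j p i k l x = 0 := by
  have h := congrArg (fun B : Matrix (Fin n) (Fin n) ℝ => (-(Bᵀ * G x) : Matrix _ _ ℝ) k l)
    (curvMatrix_bianchi hG hx p i j)
  beta_reduce at h
  rw [Matrix.transpose_add, Matrix.transpose_add, add_mul, add_mul, neg_add, neg_add,
    Matrix.transpose_zero, zero_mul, neg_zero] at h
  simp only [Matrix.add_apply, Matrix.zero_apply] at h
  -- In the cyclic sum the Christoffel terms of the first two slots cancel in pairs: `Γ` is
  -- symmetric below while `Rm` is antisymmetric there.
  have hz : ∀ a b c, ∑ s, christoffel G s a b x * riemann G s c k l x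
      = -∑ s, christoffel G s b a x * riemann G c s k l x := by
    intro a b c
    rw [← Finset.sum_neg_distrib]
    exact Finset.sum_congr rfl fun s _ => by
      rw [riemann_swap_left c s, christoffel_comm hG s a b]; ring
  rw [cov4_riemann_eq hG hx, cov4_riemann_eq hG hx, cov4_riemann_eq hG hx, hz p i j, hz i j p,
    hz j p i]
  linarith

end Geometry

/-! ### Contracted Bianchi identities, the Ricci identity and product rules. -/

section Identities

variable {n : ℕ} {U : Set (EuclideanSpace ℝ (Fin n))}
  {G : EuclideanSpace ℝ (Fin n) → Matrix (Fin n) (Fin n) ℝ} {x : EuclideanSpace ℝ (Fin n)}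

theorem pd_metric (hG : IsMetricOn G U) (hx : x ∈ U) (p i j : Fin n) :
    pd p (fun y => G y i j) x
      = ∑ s, christoffel G s p i x * G x s j + ∑ s, christoffel G s p j x * G x i s := by
  have h := congrFun (congrFun (pdMatrix_metric hG hx p) i) j
  simp only [pdMatrix, connMatrix, Matrix.add_apply, Matrix.of_apply, Matrix.mul_apply,
    Matrix.transpose_apply] at h
  rw [h]
  simp only [mul_comm]

theorem sum_inv_mul_metric (hG : IsMetricOn G U) (hx : x ∈ U) (c : Fin n → ℝ) (k : Fin n) :
    ∑ p, ∑ q, (G x)⁻¹ p q * (c p * G x q k) = c k := by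
  have h : ∀ p, ∑ q, (G x)⁻¹ p q * (c p * G x q k) = c p * (1 : Matrix (Fin n) (Fin n) ℝ) p k := by
    intro p
    rw [← hG.inv_mul hx, Matrix.mul_apply, Finset.mul_sum]
    exact Finset.sum_congr rfl fun q _ => by ring
  simp [h, Matrix.one_apply]

theorem sum_grad_mul_metric (hG : IsMetricOn G U) (hx : x ∈ U)
    (F : EuclideanSpace ℝ (Fin n) → ℝ) (k : Fin n) :
    ∑ i, grad G F i x * G x i k = pd k F x := by
  have h := sum_inv_mul_metric hG hx (fun p => pd p F x) k
  rw [← h]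
  simp only [grad, Finset.sum_mul]
  rw [Finset.sum_comm]
  exact Finset.sum_congr rfl fun p _ => Finset.sum_congr rfl fun q _ => by
    rw [hG.inv_apply_comm]; ring

theorem cov2_swap (hG : IsMetricOn G U) (hx : x ∈ U)
    {T : Fin n → Fin n → EuclideanSpace ℝ (Fin n) → ℝ}
    (hT : ∀ y ∈ U, ∀ i j, T i j y = T j i y) (p i j : Fin n) :
    cov2 G T p i j x = cov2 G T p j i x := by
  unfold cov2
  rw [pd_congr hG.isOpen hx (fun y hy => hT y hy i j) p]
  simp only [hT x hx i, hT x hx _ j]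
  ring

theorem cov2_congr (hG : IsMetricOn G U) (hx : x ∈ U)
    {T S : Fin n → Fin n → EuclideanSpace ℝ (Fin n) → ℝ}
    (h : ∀ y ∈ U, ∀ i j, T i j y = S i j y) (p i j : Fin n) :
    cov2 G T p i j x = cov2 G S p i j x := by
  unfold cov2
  rw [pd_congr hG.isOpen hx (fun y hy => h y hy i j) p]
  simp only [h x hx]

theorem cov4_riemann_pair_symm (hG : IsMetricOn G U) (hx : x ∈ U) (p i j k l : Fin n) :
    cov4 G (riemann G) p i j k l x = cov4 G (riemann G) p k l i j x := by
  unfold cov4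
  rw [pd_congr hG.isOpen hx (fun y hy => riemann_pair_symm hG hy i j k l) p]
  simp only [riemann_pair_symm hG hx _ _ k l, riemann_pair_symm hG hx i j]
  ring

theorem cov4_riemann_swap_left (p i j k l : Fin n) :
    cov4 G (riemann G) p j i k l x = -cov4 G (riemann G) p i j k l x := by
  have h : riemann G j i k l = fun y => -riemann G i j k l y := by
    funext y
    exact riemann_swap_left i j k l
  unfold cov4
  rw [h, pd_neg]
  simp only [riemann_swap_left i, riemann_swap_left _ j, mul_neg, Finset.sum_neg_distrib]
  ring

/-- Pair symmetry moves the contracted index to the second pair; the second Bianchi identity in `p,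
k, l` then contracts to Ricci derivatives. -/
theorem div4_riemann (hG : IsMetricOn G U) (hx : x ∈ U) (j k l : Fin n) :
    div4 G (riemann G) j k l x = cov2 G (ricci G) k j l x - cov2 G (ricci G) l j k x := by
  have c := fun p j l => cov2_contract hG hx (A := riemann G)
    (fun i j k l => smoothOn_riemann hG i j k l) p j l
  change ∀ p j l, cov2 G (ricci G) p j l x = _ at c
  rw [cov2_swap hG hx (fun y hy => ricci_comm hG hy) k,
    cov2_swap hG hx (fun y hy => ricci_comm hG hy) l, c, c, div4, ← Finset.sum_sub_distrib]
  refine Finset.sum_congr rfl fun p _ => ?_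
  rw [← Finset.sum_sub_distrib]
  refine Finset.sum_congr rfl fun q _ => ?_
  have b := cov4_riemann_bianchi hG hx p k l q j
  rw [cov4_riemann_swap_left k p l] at b
  rw [cov4_riemann_pair_symm hG hx p q j k l]
  linear_combination (G x)⁻¹ p q * b

/-- The contracted second Bianchi identity. -/
theorem div_ricci (hG : IsMetricOn G U) (hx : x ∈ U) (l : Fin n) :
    ∑ p, ∑ q, (G x)⁻¹ p q * cov2 G (ricci G) p q l x = pd l (scalar G) x / 2 := by
  have c := fun p j l => cov2_contract hG hx (A := riemann G)
    (fun i j k l => smoothOn_riemann hG i j k l) p j l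
  change ∀ p j l, cov2 G (ricci G) p j l x = _ at c
  have t : pd l (scalar G) x = ∑ j, ∑ k, (G x)⁻¹ j k * cov2 G (ricci G) l j k x :=
    pd_trace hG hx (smoothOn_ricci hG) l
  -- The double contraction of `∇Rm` is computed in two ways, here through `div4_riemann`.
  have e1 : ∑ j, ∑ k, (G x)⁻¹ j k * div4 G (riemann G) j k l x
      = ∑ p, ∑ q, (G x)⁻¹ p q * cov2 G (ricci G) p q l x - pd l (scalar G) x := by
    simp only [t, div4_riemann hG hx, mul_sub, Finset.sum_sub_distrib]
    rw [Finset.sum_comm]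
    congr 1
    exact Finset.sum_congr rfl fun p _ => Finset.sum_congr rfl fun q _ => by
      rw [hG.inv_apply_comm]
  -- Contracting `j, k` first instead gives `-δRic`, by antisymmetry in the first two slots.
  have e2 : ∑ j, ∑ k, (G x)⁻¹ j k * div4 G (riemann G) j k l x
      = -∑ p, ∑ q, (G x)⁻¹ p q * cov2 G (ricci G) p q l x := by
    have e3 : ∀ p q, cov2 G (ricci G) p q l x
        = -∑ j, ∑ k, (G x)⁻¹ j k * cov4 G (riemann G) p q j k l x := by
      intro p q
      rw [c]
      simp only [cov4_riemann_swap_left p q, mul_neg, Finset.sum_neg_distrib]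
    simp only [e3, div4, mul_neg, Finset.sum_neg_distrib, neg_neg, Finset.mul_sum]
    refine ((Finset.sum_congr rfl fun j _ => Finset.sum_comm).trans Finset.sum_comm).trans ?_
    refine Finset.sum_congr rfl fun p _ => ?_
    refine ((Finset.sum_congr rfl fun j _ => Finset.sum_comm).trans Finset.sum_comm).trans ?_
    exact Finset.sum_congr rfl fun q _ => Finset.sum_congr rfl fun j _ =>
      Finset.sum_congr rfl fun k _ => by ring
  linarith

/-- The Ricci identity for the differential of a function. -/
theorem cov2_hess_sub (hG : IsMetricOn G U) (hx : x ∈ U) {F : EuclideanSpace ℝ (Fin n) → ℝ}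
    (hF : ContDiffOn ℝ ∞ F U) (j k l : Fin n) :
    cov2 G (hess G F) k l j x - cov2 G (hess G F) l k j x
      = -contractGrad G F (riemann G) j k l x := by
  have hc : ∀ s a b, ContDiffOn ℝ ∞ (christoffel G s a b) U :=
    fun s a b => smoothEntries_connMatrix hG a s b
  have hd := fun a => smoothOn_pd hG.isOpen hF a
  have e : ∀ a b, pd a (hess G F b j) x = pd a (pd b (pd j F)) x
      - ∑ s, (pd a (christoffel G s b j) x * pd s F x
        + christoffel G s b j x * pd a (pd s F) x) := by
    intro a b
    unfold hess
    rw [pd_sub hG.isOpen (smoothOn_pd hG.isOpen (hd j) b)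
      (ContDiffOn.sum fun s _ => (hc s b j).mul (hd s)) hx,
      pd_sum _ hG.isOpen (fun s => (hc s b j).mul (hd s)) hx]
    congr 1
    exact Finset.sum_congr rfl fun s _ => pd_mul hG.isOpen (hc s b j) (hd s) hx a
  -- Pair symmetry puts the gradient index in the slot lowered by `G`, so the metric cancels against
  -- the inverse metric in `grad`.
  have r : contractGrad G F (riemann G) j k l x
      = ∑ q, (secondCov G k l j q x - secondCov G l k j q x) * pd q F x := by
    have h1 : ∀ i, riemann G i j k l x
        = ∑ q, (secondCov G k l j q x - secondCov G l k j q x) * G x q i := by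
      intro i
      rw [riemann_pair_symm hG hx, riemann_swap_right hG hx]
      simp only [riemann, ← Finset.sum_neg_distrib]
      exact Finset.sum_congr rfl fun q _ => by ring
    simp only [contractGrad, h1, Finset.mul_sum]
    rw [Finset.sum_comm]
    refine Finset.sum_congr rfl fun q _ => ?_
    rw [← sum_grad_mul_metric hG hx F q, Finset.mul_sum]
    exact Finset.sum_congr rfl fun i _ => by rw [hG.apply_comm x q i]; ring
  -- The terms `Γ ∂∂F` cancel the Leibniz terms of `e` after antisymmetrization; the terms `Γ Γ ∂F`
  -- are the quadratic part of the curvature.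
  have w : ∀ a b, ∑ s, christoffel G s a j x * hess G F b s x
      = ∑ s, christoffel G s a j x * pd b (pd s F) x
        - ∑ q, (∑ p, christoffel G p a j x * christoffel G q b p x) * pd q F x := by
    intro a b
    simp only [hess, mul_sub, Finset.sum_sub_distrib, Finset.mul_sum, Finset.sum_mul]
    rw [Finset.sum_comm (γ := Fin n)]
    congr 1
    exact Finset.sum_congr rfl fun q _ => Finset.sum_congr rfl fun p _ => by ring
  unfold cov2
  rw [r, e, e, w, w, pd_comm hG.isOpen (hd j) hx k l]
  simp only [secondCov, christoffel_comm hG _ l k, sub_mul, add_mul, Finset.sum_sub_distrib,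
    Finset.sum_add_distrib]
  ring

theorem hess_comm (hG : IsMetricOn G U) (hx : x ∈ U) {F : EuclideanSpace ℝ (Fin n) → ℝ}
    (hF : ContDiffOn ℝ ∞ F U) (i j : Fin n) : hess G F i j x = hess G F j i x := by
  unfold hess
  rw [pd_comm hG.isOpen hF hx]
  simp only [christoffel_comm hG _ i j]

theorem smoothOn_hess (hG : IsMetricOn G U) {F : EuclideanSpace ℝ (Fin n) → ℝ}
    (hF : ContDiffOn ℝ ∞ F U) (i j : Fin n) : ContDiffOn ℝ ∞ (hess G F i j) U := by
  have hd := fun a => smoothOn_pd hG.isOpen hF a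
  exact (smoothOn_pd hG.isOpen (hd j) i).sub
    (ContDiffOn.sum fun s _ => ContDiffOn.mul (smoothEntries_connMatrix hG i s j) (hd s))

theorem cov2_mul_metric (hG : IsMetricOn G U) (hx : x ∈ U) {F : EuclideanSpace ℝ (Fin n) → ℝ}
    (hF : ContDiffOn ℝ ∞ F U) (p i j : Fin n) :
    cov2 G (fun i j y => F y * G y i j) p i j x = pd p F x * G x i j := by
  unfold cov2
  rw [pd_mul hG.isOpen hF (hG.smooth i j) hx, pd_metric hG hx]
  simp only [mul_left_comm _ (F x), ← Finset.mul_sum]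
  ring

theorem cov2_sub (hG : IsMetricOn G U) (hx : x ∈ U)
    {T S : Fin n → Fin n → EuclideanSpace ℝ (Fin n) → ℝ}
    (hT : ∀ i j, ContDiffOn ℝ ∞ (T i j) U) (hS : ∀ i j, ContDiffOn ℝ ∞ (S i j) U)
    (p i j : Fin n) :
    cov2 G (fun i j y => T i j y - S i j y) p i j x = cov2 G T p i j x - cov2 G S p i j x := by
  unfold cov2
  rw [pd_sub hG.isOpen (hT i j) (hS i j) hx]
  simp only [mul_sub, Finset.sum_sub_distrib]
  ring

theorem cov2_const_mul (hG : IsMetricOn G U) (hx : x ∈ U) (c : ℝ)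
    {T : Fin n → Fin n → EuclideanSpace ℝ (Fin n) → ℝ}
    (hT : ∀ i j, ContDiffOn ℝ ∞ (T i j) U) (p i j : Fin n) :
    cov2 G (fun i j y => c * T i j y) p i j x = c * cov2 G T p i j x := by
  unfold cov2
  rw [pd_const_mul hG.isOpen c (hT i j) hx]
  simp only [mul_left_comm _ c, ← Finset.mul_sum]
  ring

theorem cov2_differential_mul (hG : IsMetricOn G U) (hx : x ∈ U)
    {F : EuclideanSpace ℝ (Fin n) → ℝ} (hF : ContDiffOn ℝ ∞ F U) (p i j : Fin n) :
    cov2 G (fun i j y => pd i F y * pd j F y) p i j x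
      = hess G F p i x * pd j F x + pd i F x * hess G F p j x := by
  have hd := fun a => smoothOn_pd hG.isOpen hF a
  unfold cov2 hess
  rw [pd_mul hG.isOpen (hd i) (hd j) hx]
  simp only [mul_left_comm _ (pd i F x), ← mul_assoc _ _ (pd j F x), ← Finset.mul_sum,
    ← Finset.sum_mul]
  ring

theorem pd_gradInner_self (hG : IsMetricOn G U) (hx : x ∈ U)
    {F : EuclideanSpace ℝ (Fin n) → ℝ} (hF : ContDiffOn ℝ ∞ F U) (p : Fin n) :
    pd p (gradInner G F F) x = 2 * ∑ i, grad G F i x * hess G F i p x := by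
  have hd := fun a => smoothOn_pd hG.isOpen hF a
  -- As the trace of `dF ⊗ dF`, `|∇F|²` can be differentiated covariantly by `pd_trace`.
  have e : gradInner G F F = trace G (fun i j y => pd i F y * pd j F y) := by
    funext y
    exact Finset.sum_congr rfl fun i _ => Finset.sum_congr rfl fun j _ => mul_assoc _ _ _
  rw [e, pd_trace hG hx fun i j => (hd i).mul (hd j)]
  simp only [cov2_differential_mul hG hx hF, mul_add, Finset.sum_add_distrib, two_mul]
  congr 1
  · simp only [grad, Finset.sum_mul]
    exact Finset.sum_congr rfl fun i _ => Finset.sum_congr rfl fun j _ => by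
      rw [hess_comm hG hx hF]; ring
  · simp only [grad, Finset.sum_mul]
    rw [Finset.sum_comm]
    exact Finset.sum_congr rfl fun i _ => Finset.sum_congr rfl fun j _ => by
      rw [hess_comm hG hx hF, hG.inv_apply_comm]; ring

/-! ### Divergence of a Kulkarni-Nomizu product with the metric -/

theorem smoothOn_kulkarniNomizu (hG : IsMetricOn G U)
    {h : Fin n → Fin n → EuclideanSpace ℝ (Fin n) → ℝ} (hh : ∀ i j, ContDiffOn ℝ ∞ (h i j) U)
    (i j k l : Fin n) : ContDiffOn ℝ ∞ (kulkarniNomizu G h i j k l) U :=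
  ((((hh i k).mul (hG.smooth j l)).add ((hh j l).mul (hG.smooth i k))).sub
    ((hh i l).mul (hG.smooth j k))).sub ((hh j k).mul (hG.smooth i l))

theorem cov4_kulkarniNomizu (hG : IsMetricOn G U) (hx : x ∈ U)
    {h : Fin n → Fin n → EuclideanSpace ℝ (Fin n) → ℝ} (hh : ∀ i j, ContDiffOn ℝ ∞ (h i j) U)
    (p i j k l : Fin n) :
    cov4 G (kulkarniNomizu G h) p i j k l x =
      cov2 G h p i k x * G x j l + cov2 G h p j l x * G x i k
        - cov2 G h p i l x * G x j k - cov2 G h p j k x * G x i l := by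
  have m := fun a b c d => (hh a b).mul (hG.smooth c d)
  have e : pd p (kulkarniNomizu G h i j k l) x =
      (pd p (h i k) x * G x j l + h i k x * pd p (fun y => G y j l) x)
      + (pd p (h j l) x * G x i k + h j l x * pd p (fun y => G y i k) x)
      - (pd p (h i l) x * G x j k + h i l x * pd p (fun y => G y j k) x)
      - (pd p (h j k) x * G x i l + h j k x * pd p (fun y => G y i l) x) := by
    unfold kulkarniNomizu
    rw [pd_sub hG.isOpen (((m _ _ _ _).add (m _ _ _ _)).sub (m _ _ _ _)) (m _ _ _ _) hx,
      pd_sub hG.isOpen ((m _ _ _ _).add (m _ _ _ _)) (m _ _ _ _) hx,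
      pd_add hG.isOpen (m _ _ _ _) (m _ _ _ _) hx, pd_mul hG.isOpen (hh _ _) (hG.smooth _ _) hx,
      pd_mul hG.isOpen (hh _ _) (hG.smooth _ _) hx, pd_mul hG.isOpen (hh _ _) (hG.smooth _ _) hx,
      pd_mul hG.isOpen (hh _ _) (hG.smooth _ _) hx]
  unfold cov4
  rw [e]
  simp only [pd_metric hG hx, cov2, kulkarniNomizu, mul_add, mul_sub, Finset.sum_add_distrib,
    Finset.sum_sub_distrib]
  have a1 : ∀ (c : Fin n → ℝ) (t : Fin n → ℝ) (r : ℝ),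
      ∑ s, c s * (t s * r) = (∑ s, c s * t s) * r := fun c t r => by
    simp only [Finset.sum_mul, mul_assoc]
  have a2 : ∀ (c : Fin n → ℝ) (t : Fin n → ℝ) (r : ℝ),
      ∑ s, c s * (r * t s) = (∑ s, c s * t s) * r := fun c t r => by
    simp only [Finset.sum_mul]
    exact Finset.sum_congr rfl fun s _ => by ring
  simp only [a1, a2]
  ring

theorem div4_kulkarniNomizu (hG : IsMetricOn G U) (hx : x ∈ U)
    {h : Fin n → Fin n → EuclideanSpace ℝ (Fin n) → ℝ} (hh : ∀ i j, ContDiffOn ℝ ∞ (h i j) U)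
    (j k l : Fin n) :
    div4 G (kulkarniNomizu G h) j k l x =
      (∑ p, ∑ q, (G x)⁻¹ p q * cov2 G h p q k x) * G x j l + cov2 G h k j l x
        - (∑ p, ∑ q, (G x)⁻¹ p q * cov2 G h p q l x) * G x j k - cov2 G h l j k x := by
  rw [← sum_inv_mul_metric hG hx (fun p => cov2 G h p j l x) k,
    ← sum_inv_mul_metric hG hx (fun p => cov2 G h p j k x) l]
  simp only [div4, cov4_kulkarniNomizu hG hx hh, Finset.sum_mul, ← Finset.sum_add_distrib,
    ← Finset.sum_sub_distrib]
  exact Finset.sum_congr rfl fun p _ => Finset.sum_congr rfl fun q _ => by ring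

theorem div4_sub (hG : IsMetricOn G U) (hx : x ∈ U)
    {A B : Fin n → Fin n → Fin n → Fin n → EuclideanSpace ℝ (Fin n) → ℝ}
    (hA : ∀ i j k l, ContDiffOn ℝ ∞ (A i j k l) U) (hB : ∀ i j k l, ContDiffOn ℝ ∞ (B i j k l) U)
    (j k l : Fin n) :
    div4 G (fun i j k l y => A i j k l y - B i j k l y) j k l x
      = div4 G A j k l x - div4 G B j k l x := by
  simp only [div4, ← Finset.sum_sub_distrib]
  refine Finset.sum_congr rfl fun p _ => Finset.sum_congr rfl fun q _ => ?_
  unfold cov4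
  rw [pd_sub hG.isOpen (hA q j k l) (hB q j k l) hx]
  simp only [mul_sub, Finset.sum_sub_distrib]
  ring

theorem contractGrad_kulkarniNomizu (hG : IsMetricOn G U) (hx : x ∈ U)
    (F : EuclideanSpace ℝ (Fin n) → ℝ) (h : Fin n → Fin n → EuclideanSpace ℝ (Fin n) → ℝ)
    (j k l : Fin n) :
    contractGrad G F (kulkarniNomizu G h) j k l x =
      (∑ i, grad G F i x * h i k x) * G x j l + h j l x * pd k F x
        - (∑ i, grad G F i x * h i l x) * G x j k - h j k x * pd l F x := by
  rw [← sum_grad_mul_metric hG hx F k, ← sum_grad_mul_metric hG hx F l]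
  simp only [contractGrad, kulkarniNomizu, Finset.sum_mul, Finset.mul_sum,
    ← Finset.sum_add_distrib, ← Finset.sum_sub_distrib]
  exact Finset.sum_congr rfl fun i _ => by ring

end Identities

/-! ### Consequences of the quasi-Einstein equations. -/

section QuasiEinstein

variable {n : ℕ} {U : Set (EuclideanSpace ℝ (Fin n))}
  {G : EuclideanSpace ℝ (Fin n) → Matrix (Fin n) (Fin n) ℝ} {x : EuclideanSpace ℝ (Fin n)}
  {F : EuclideanSpace ℝ (Fin n) → ℝ}

/-- In the antisymmetrized `∇Ric` the metric term vanishes and the Ricci identity handles `∇∇²F`.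
The parameter `a` serves both cases: `1/τ` for finite `m`, and `0` for `m = ±∞`. -/
theorem div4_riemann_of_ricci_eq (hG : IsMetricOn G U) (hx : x ∈ U) (hF : ContDiffOn ℝ ∞ F U)
    {a μ : ℝ} (hric : ∀ y ∈ U, ∀ i j, ricci G i j y
      = μ * G y i j - hess G F i j y - a * (pd i F y * pd j F y)) (j k l : Fin n) :
    div4 G (riemann G) j k l x = contractGrad G F (riemann G) j k l x
      - a * (hess G F j k x * pd l F x - hess G F j l x * pd k F x) := by
  have hd := fun i => smoothOn_pd hG.isOpen hF i
  have hdd := fun i j => (hd i).mul (hd j)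
  have hg : ∀ i j, ContDiffOn ℝ ∞ (fun y => μ * G y i j) U :=
    fun i j => contDiffOn_const.mul (hG.smooth i j)
  have hh := smoothOn_hess hG hF
  have c : ∀ p i j, cov2 G (ricci G) p i j x = -cov2 G (hess G F) p i j x
      - a * (hess G F p i x * pd j F x + pd i F x * hess G F p j x) := by
    intro p i j
    rw [cov2_congr hG hx hric, cov2_sub hG hx (fun i j => (hg i j).sub (hh i j))
      (fun i j => contDiffOn_const.mul (hdd i j)), cov2_sub hG hx hg hh,
      cov2_mul_metric hG hx contDiffOn_const, cov2_const_mul hG hx a hdd,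
      cov2_differential_mul hG hx hF, pd_const]
    ring
  have r := cov2_hess_sub hG hx hF j k l
  rw [cov2_swap hG hx (fun y hy => hess_comm hG hy hF) k,
    cov2_swap hG hx (fun y hy => hess_comm hG hy hF) l] at r
  rw [div4_riemann hG hx, c, c, hess_comm hG hx hF l k, hess_comm hG hx hF j k,
    hess_comm hG hx hF j l]
  linear_combination -r

/-- The parts containing `δRm` match because `∇P` contributes `(1/τ) δRm`; `hscal` makes the terms
proportional to `g` match. -/
theorem div4_weightedWeyl (hG : IsMetricOn G U) (hx : x ∈ U) (hF : ContDiffOn ℝ ∞ F U)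
    {r τ μ : ℝ} (hτ : r + n - 2 = τ) (hτ0 : τ ≠ 0) (hτ1 : τ + 1 ≠ 0)
    (hric : ∀ y ∈ U, ∀ i j, ricci G i j y
      = μ * G y i j - hess G F i j y - 1 / τ * (pd i F y * pd j F y))
    (hscal : ∀ k, τ * pd k (scalar G) x = 2 * (τ + 1) * ∑ i, grad G F i x * ricci G i k x
      - 2 * scalar G x * pd k F x + 2 * (n - 1) * μ * pd k F x) (j k l : Fin n) :
    div4 G (weightedWeyl G (r : EReal) μ) j k l x
      = (τ - 1) / τ * contractGrad G F (weightedWeyl G (r : EReal) μ) j k l x := by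
  have hP : weightedSchouten G (r : EReal) μ = fun i j y =>
      1 / τ * (ricci G i j y - (scalar G y + r * μ) / (2 * (τ + 1)) * G y i j) := by
    funext i j y
    have : r + n - 1 = τ + 1 := by linarith
    simp [weightedSchouten, hτ, this]
  set s : EuclideanSpace ℝ (Fin n) → ℝ := fun y => 1 / (2 * (τ + 1)) * (scalar G y + r * μ)
    with hs_def
  have hs : ContDiffOn ℝ ∞ s U :=
    contDiffOn_const.mul ((smoothOn_scalar hG).add contDiffOn_const)
  have hds : ∀ k, pd k s x = 1 / (2 * (τ + 1)) * pd k (scalar G) x := by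
    intro k
    rw [hs_def, pd_const_mul hG.isOpen _ ((smoothOn_scalar hG).add contDiffOn_const) hx,
      pd_add hG.isOpen (smoothOn_scalar hG) contDiffOn_const hx, pd_const, add_zero]
  set P : Fin n → Fin n → EuclideanSpace ℝ (Fin n) → ℝ :=
    fun i j y => 1 / τ * (ricci G i j y - s y * G y i j) with hP_def
  have hPP : weightedSchouten G (r : EReal) μ = P := by
    rw [hP, hP_def]
    funext i j y
    rw [hs_def]
    ring
  have hsg := fun i j => hs.mul (hG.smooth i j)
  have hPs : ∀ i j, ContDiffOn ℝ ∞ (P i j) U := fun i j =>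
    contDiffOn_const.mul ((smoothOn_ricci hG i j).sub (hsg i j))
  have hcP : ∀ p i j, cov2 G P p i j x
      = 1 / τ * (cov2 G (ricci G) p i j x - pd p s x * G x i j) := by
    intro p i j
    rw [hP_def, cov2_const_mul hG hx _ fun i j => (smoothOn_ricci hG i j).sub (hsg i j),
      cov2_sub hG hx (smoothOn_ricci hG) hsg, cov2_mul_metric hG hx hs]
  have hdP : ∀ k, ∑ p, ∑ q, (G x)⁻¹ p q * cov2 G P p q k x
      = 1 / τ * (pd k (scalar G) x / 2 - pd k s x) := by
    intro k
    rw [← div_ricci hG hx, ← sum_inv_mul_metric hG hx (fun p => pd p s x) k]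
    simp only [hcP, ← Finset.sum_sub_distrib, Finset.mul_sum]
    exact Finset.sum_congr rfl fun p _ => Finset.sum_congr rfl fun q _ => by ring
  have hgP : ∀ k, ∑ i, grad G F i x * P i k x
      = 1 / τ * (∑ i, grad G F i x * ricci G i k x - s x * pd k F x) := by
    intro k
    rw [← sum_grad_mul_metric hG hx F k]
    simp only [hP_def, ← Finset.sum_sub_distrib, Finset.mul_sum]
    exact Finset.sum_congr rfl fun i _ => by ring
  have hA : weightedWeyl G (r : EReal) μ
      = fun i j k l y => riemann G i j k l y - kulkarniNomizu G P i j k l y := by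
    unfold weightedWeyl
    rw [hPP]
  have hcA : contractGrad G F (weightedWeyl G (r : EReal) μ) j k l x
      = contractGrad G F (riemann G) j k l x
        - contractGrad G F (kulkarniNomizu G P) j k l x := by
    simp only [hA, contractGrad, mul_sub, Finset.sum_sub_distrib]
  have e1 := div4_riemann hG hx j k l
  have e2 := div4_riemann_of_ricci_eq hG hx hF hric j k l
  have hk := hscal k
  have hl := hscal l
  rw [hcA, hA, div4_sub hG hx (smoothOn_riemann hG) (smoothOn_kulkarniNomizu hG hPs),
    div4_kulkarniNomizu hG hx hPs, contractGrad_kulkarniNomizu hG hx, hdP, hdP, hcP, hcP, hgP,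
    hgP, hds, hds]
  have hHk : hess G F j k x = μ * G x j k - 1 / τ * (pd j F x * pd k F x) - ricci G j k x := by
    rw [hric x hx j k]
    ring
  have hHl : hess G F j l x = μ * G x j l - 1 / τ * (pd j F x * pd l F x) - ricci G j l x := by
    rw [hric x hx j l]
    ring
  -- With `hC` and `hI`, both `∇ₖRic` and `ι_{∇F} Rm` are expressed through `δRm`; once the Hessian
  -- and `dR` are eliminated as well, the claim is a rational identity in the remaining quantities.
  have hC : cov2 G (ricci G) k j l x = div4 G (riemann G) j k l x + cov2 G (ricci G) l j k x := by
    linarith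
  have hI : contractGrad G F (riemann G) j k l x = div4 G (riemann G) j k l x
      + 1 / τ * (hess G F j k x * pd l F x - hess G F j l x * pd k F x) := by
    linarith
  have hr : r = τ + 2 - n := by linarith
  rw [mul_comm, ← eq_div_iff hτ0] at hk hl
  have hsx : s x = 1 / (2 * (τ + 1)) * (scalar G x + (τ + 2 - n) * μ) := by
    rw [hs_def, hr]
  have hPx : ∀ i j, P i j x = 1 / τ * (ricci G i j x - s x * G x i j) := fun _ _ => rfl
  rw [hI, hHk, hHl, hC, hk, hl, hPx, hPx, hsx]
  field_simp
  ring

theorem trace_add (S T : Fin n → Fin n → EuclideanSpace ℝ (Fin n) → ℝ) :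
    trace G (fun i j y => S i j y + T i j y) x = trace G S x + trace G T x := by
  simp only [trace, mul_add, Finset.sum_add_distrib]

theorem trace_mul_left (c : EuclideanSpace ℝ (Fin n) → ℝ)
    (T : Fin n → Fin n → EuclideanSpace ℝ (Fin n) → ℝ) :
    trace G (fun i j y => c y * T i j y) x = c x * trace G T x := by
  simp only [trace, Finset.mul_sum, mul_left_comm]

theorem pd_exp_div (hU : IsOpen U) (hF : ContDiffOn ℝ ∞ F U) (hx : x ∈ U) (τ : ℝ) (i : Fin n) :
    pd i (fun y => Real.exp (F y / τ)) x = Real.exp (F x / τ) * (1 / τ * pd i F x) := by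
  have e : (fun y => F y / τ) = fun y => 1 / τ * F y := by
    funext y
    ring
  rw [pd_exp hU (hF.div_const τ) hx, e, pd_const_mul hU _ hF hx]

theorem hess_exp_div (hG : IsMetricOn G U) (hF : ContDiffOn ℝ ∞ F U) (hx : x ∈ U) (τ : ℝ)
    (i j : Fin n) : hess G (fun y => Real.exp (F y / τ)) i j x = Real.exp (F x / τ) *
      (1 / τ * hess G F i j x + 1 / τ * (1 / τ) * (pd i F x * pd j F x)) := by
  have hE : ContDiffOn ℝ ∞ (fun y => Real.exp (F y / τ)) U := (hF.div_const τ).exp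
  have hd := smoothOn_pd hG.isOpen hF j
  unfold hess
  rw [pd_congr hG.isOpen hx (fun y hy => pd_exp_div hG.isOpen hF hy τ j) i,
    pd_mul hG.isOpen hE (contDiffOn_const.mul hd) hx, pd_const_mul hG.isOpen _ hd hx]
  have e : ∑ k, christoffel G k i j x * pd k (fun y => Real.exp (F y / τ)) x
      = Real.exp (F x / τ) * (1 / τ) * ∑ k, christoffel G k i j x * pd k F x := by
    rw [Finset.mul_sum]
    exact Finset.sum_congr rfl fun k _ => by
      rw [pd_exp_div hG.isOpen hF hx]; ring
  rw [e, pd_exp_div hG.isOpen hF hx]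
  ring

theorem gradInner_exp_div (hG : IsMetricOn G U) (hF : ContDiffOn ℝ ∞ F U) (hx : x ∈ U) (τ : ℝ) :
    gradInner G (fun y => Real.exp (F y / τ)) (fun y => Real.exp (F y / τ)) x
      = (Real.exp (F x / τ) * (1 / τ)) ^ 2 * gradInner G F F x := by
  simp only [gradInner, pd_exp_div hG.isOpen hF hx, Finset.mul_sum]
  exact Finset.sum_congr rfl fun i _ => Finset.sum_congr rfl fun j _ => by ring

theorem laplacian_exp_div (hG : IsMetricOn G U) (hF : ContDiffOn ℝ ∞ F U) (hx : x ∈ U) (τ : ℝ) :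
    laplacian G (fun y => Real.exp (F y / τ)) x = Real.exp (F x / τ) *
      (1 / τ * laplacian G F x + 1 / τ * (1 / τ) * gradInner G F F x) := by
  simp only [laplacian, trace, gradInner, hess_exp_div hG hF hx, Finset.mul_sum,
    ← Finset.sum_add_distrib]
  exact Finset.sum_congr rfl fun i _ => Finset.sum_congr rfl fun j _ => by ring

theorem hess_const (c : ℝ) (i j : Fin n) : hess G (fun _ => c) i j x = 0 := by
  have h : ∀ k : Fin n, pd k (fun _ : EuclideanSpace ℝ (Fin n) => c) = fun _ => 0 := fun k => by
    funext y
    exact pd_const c k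
  simp [hess, h, pd_const]

theorem laplacian_const (c : ℝ) : laplacian G (fun _ => c) x = 0 := by
  simp [laplacian, trace, hess_const]

theorem gradInner_const_right (c : ℝ) : gradInner G F (fun _ => c) x = 0 := by
  simp [gradInner, pd_const]

/-- For `v = 1` the second scale equation determines the trace of the Bakry-Emery tensor. -/
theorem QESystem.trace_eq (hG : IsMetricOn G U) (hF : ContDiffOn ℝ ∞ F U) (hx : x ∈ U)
    {r τ lam μ : ℝ} (hτ : r + n - 2 = τ) (hτ0 : τ ≠ 0)
    (h : QESystem G (fun y => Real.exp (F y / τ)) (fun _ => 1) r lam μ x) :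
    n * μ = scalar G x + laplacian G F x + 1 / τ * gradInner G F F x := by
  have hE := Real.exp_pos (F x / τ)
  have h2 := h.mu_eq
  rw [laplacian_exp_div hG hF hx, laplacian_const, gradInner_const_right,
    gradInner_const_right, hτ] at h2
  have h3 : Real.exp (F x / τ) ^ 2 * (n * μ) = Real.exp (F x / τ) ^ 2 *
      (scalar G x + laplacian G F x + 1 / τ * gradInner G F F x) := by
    linear_combination h2 + Real.exp (F x / τ) ^ 2 *
      (laplacian G F x + 1 / τ * gradInner G F F x) * mul_one_div_cancel hτ0
  exact mul_left_cancel₀ (by positivity) h3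

/-- Since `τ ∇²u = u (∇²F + (1/τ) dF ⊗ dF)`, the first scale equation says that the Bakry-Emery
tensor is pure trace, and `QESystem.trace_eq` gives the trace as `n μ`. -/
theorem QESystem.ricci_eq (hG : IsMetricOn G U) (hF : ContDiffOn ℝ ∞ F U) (hx : x ∈ U)
    {r τ lam μ : ℝ} (hτ : r + n - 2 = τ) (hτ0 : τ ≠ 0)
    (h : QESystem G (fun y => Real.exp (F y / τ)) (fun _ => 1) r lam μ x) (i j : Fin n) :
    ricci G i j x = μ * G x i j - hess G F i j x - 1 / τ * (pd i F x * pd j F x) := by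
  have hE := Real.exp_pos (F x / τ)
  have hn : (n : ℝ) ≠ 0 := by
    have : NeZero n := ⟨fun h0 => by subst h0; exact i.elim0⟩
    exact NeZero.ne _
  have h1 := h.tracefree_eq i j
  have h2 := h.trace_eq hG hF hx hτ hτ0
  have e : (fun i j y => Real.exp (F y / τ) * 1 * ricci G i j y
      + (r + n - 2) * 1 * hess G (fun y => Real.exp (F y / τ)) i j y
      - r * Real.exp (F y / τ) * hess G (fun _ => 1) i j y)
      = fun i j y => Real.exp (F y / τ) * ricci G i j y
        + τ * hess G (fun y => Real.exp (F y / τ)) i j y := by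
    funext i j y
    rw [hess_const, hτ]
    ring
  have t : trace G (fun i j y => Real.exp (F y / τ) * ricci G i j y
        + τ * hess G (fun y => Real.exp (F y / τ)) i j y) x
      = Real.exp (F x / τ) * (n * μ) := by
    rw [trace_add, trace_mul_left, trace_mul_left (fun _ => τ)]
    change _ * scalar G x + τ * laplacian G _ x = _
    rw [laplacian_exp_div hG hF hx, h2]
    field_simp
    ring
  rw [e, tracefree, t, hess_exp_div hG hF hx] at h1
  refine mul_left_cancel₀ hE.ne' ?_
  linear_combination h1 - Real.exp (F x / τ) *
    (hess G F i j x + 1 / τ * (pd i F x * pd j F x)) * mul_one_div_cancel hτ0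
    + Real.exp (F x / τ) * μ * G x i j * one_div_mul_cancel hn

/-- The `λ` equation after substituting `ΔF` from `QESystem.trace_eq` and dividing by `u²`. The
factor `u⁻²` is written `exp (F / (-τ / 2))` so that `pd_exp_div` applies to it. -/
theorem QESystem.scalar_eq (hG : IsMetricOn G U) (hF : ContDiffOn ℝ ∞ F U) (hx : x ∈ U)
    {r τ lam μ : ℝ} (hn : n ≠ 0) (hτ : r + n - 2 = τ) (hτ0 : τ ≠ 0)
    (h : QESystem G (fun y => Real.exp (F y / τ)) (fun _ => 1) r lam μ x) :
    scalar G x = ((τ + n) * μ - (τ + 1) / τ * gradInner G F F x)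
      - τ * lam * Real.exp (F x / (-τ / 2)) := by
  have hn' : (n : ℝ) ≠ 0 := Nat.cast_ne_zero.2 hn
  have h2 := h.trace_eq hG hF hx hτ hτ0
  have h3 := h.lam_eq
  have e : Real.exp (F x / τ) ^ 2 * Real.exp (F x / (-τ / 2)) = 1 := by
    rw [← Real.exp_nat_mul, ← Real.exp_add, Real.exp_eq_one_iff]
    field_simp
    ring
  have hr : r = τ + 2 - n := by linarith
  rw [laplacian_exp_div hG hF hx, laplacian_const, gradInner_const_right,
    gradInner_exp_div hG hF hx, hr] at h3
  have hl : laplacian G F x = n * μ - scalar G x - 1 / τ * gradInner G F F x := by linarith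
  rw [hl] at h3
  generalize Real.exp (F x / (-τ / 2)) = w at e ⊢
  have h4 : w * (n * lam) = scalar G x + (τ + n) * (n * μ - scalar G x) / τ
      - (τ + 1) * n * gradInner G F F x / τ ^ 2 := by
    linear_combination w * h3 + (scalar G x + (τ + n) * (n * μ - scalar G x) / τ
      - (τ + 1) * n * gradInner G F F x / τ ^ 2) * e
  field_simp at h4 ⊢
  refine mul_left_cancel₀ hn' ?_
  linear_combination h4

theorem pd_scalar_of_QESystem (hG : IsMetricOn G U) (hF : ContDiffOn ℝ ∞ F U) (hx : x ∈ U)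
    {r τ lam μ : ℝ} (hτ : r + n - 2 = τ) (hτ0 : τ ≠ 0)
    (h : ∀ y ∈ U, QESystem G (fun y => Real.exp (F y / τ)) (fun _ => 1) r lam μ y) (k : Fin n) :
    τ * pd k (scalar G) x = 2 * (τ + 1) * ∑ i, grad G F i x * ricci G i k x
      - 2 * scalar G x * pd k F x + 2 * (n - 1) * μ * pd k F x := by
  have hn : n ≠ 0 := fun h0 => by subst h0; exact k.elim0
  have hd := fun i => smoothOn_pd hG.isOpen hF i
  have hgr : ContDiffOn ℝ ∞ (gradInner G F F) U := by
    unfold gradInner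
    exact ContDiffOn.sum fun i _ => ContDiffOn.sum fun j _ =>
      ContDiffOn.mul (ContDiffOn.mul (hG.smooth_inv i j) (hd i)) (hd j)
  have hs := (h x hx).scalar_eq hG hF hx hn hτ hτ0
  have hE : ContDiffOn ℝ ∞ (fun y => Real.exp (F y / (-τ / 2))) U := (hF.div_const _).exp
  have hds : pd k (scalar G) x = -((τ + 1) / τ * pd k (gradInner G F F) x)
      + 2 * lam * Real.exp (F x / (-τ / 2)) * pd k F x := by
    rw [pd_congr hG.isOpen hx
      (fun y hy => (h y hy).scalar_eq hG hF hy hn hτ hτ0) k,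
      pd_sub hG.isOpen (contDiffOn_const.sub (contDiffOn_const.mul hgr))
        (contDiffOn_const.mul hE) hx,
      pd_sub hG.isOpen contDiffOn_const (contDiffOn_const.mul hgr) hx,
      pd_const_mul hG.isOpen _ hgr hx, pd_const_mul hG.isOpen _ hE hx,
      pd_exp_div hG.isOpen hF hx, pd_const]
    field_simp
    ring
  have hgg : ∑ i, grad G F i x * pd i F x = gradInner G F F x := by
    simp only [grad, gradInner, Finset.sum_mul]
    rw [Finset.sum_comm]
    exact Finset.sum_congr rfl fun i _ => Finset.sum_congr rfl fun j _ => by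
      rw [hG.inv_apply_comm]
  have hgh : ∑ i, grad G F i x * ricci G i k x = μ * pd k F x
      - ∑ i, grad G F i x * hess G F i k x - 1 / τ * gradInner G F F x * pd k F x := by
    have e1 : ∑ i, grad G F i x * (μ * G x i k) = μ * pd k F x := by
      rw [← sum_grad_mul_metric hG hx F k, Finset.mul_sum]
      exact Finset.sum_congr rfl fun i _ => by ring
    have e2 : ∑ i, grad G F i x * (1 / τ * (pd i F x * pd k F x))
        = 1 / τ * gradInner G F F x * pd k F x := by
      rw [← hgg, Finset.mul_sum, Finset.sum_mul]
      exact Finset.sum_congr rfl fun i _ => by ring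
    simp only [(h x hx).ricci_eq hG hF hx hτ hτ0, mul_sub, Finset.sum_sub_distrib, e1, e2]
  rw [hds, pd_gradInner_self hG hx hF, hgh]
  -- The undifferentiated scalar curvature formula removes `λ` and the exponential from `dR`.
  have hl : τ * lam * Real.exp (F x / (-τ / 2))
      = (τ + n) * μ - (τ + 1) / τ * gradInner G F F x - scalar G x := by linarith
  generalize Real.exp (F x / (-τ / 2)) = w at hl ⊢
  field_simp at hl ⊢
  linear_combination pd k F x * hl

end QuasiEinstein

/-- Identifies `g(Dv, Dv)` with the quadratic form of the chart metric; stated abstractly to keep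
tangent spaces out of the expansion. -/
theorem apply_sum_smul_sum_smul {ι E V : Type*} [Fintype ι] [AddCommGroup E] [Module ℝ E]
    [TopologicalSpace E] [AddCommGroup V] [Module ℝ V] [TopologicalSpace V]
    [IsTopologicalAddGroup V] [ContinuousConstSMul ℝ V] (D : E →L[ℝ] V)
    (b : V →L[ℝ] V →L[ℝ] ℝ) (c : ι → ℝ) (s : ι → E) :
    b (D (∑ i, c i • s i)) (D (∑ i, c i • s i))
      = ∑ i, ∑ j, c i * (b (D (s i)) (D (s j)) * c j) := by
  simp only [map_sum, map_smul, sum_apply, smul_apply, smul_eq_mul, Finset.mul_sum]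
  rw [Finset.sum_comm]
  exact Finset.sum_congr rfl fun i _ => Finset.sum_congr rfl fun j _ => by ring

/-! ### From the manifold to charts: the components form a smooth nondegenerate metric. -/

section Charts

variable {n : ℕ} {M : Type*} [TopologicalSpace M] [ChartedSpace (EuclideanSpace ℝ (Fin n)) M]
  {e : OpenPartialHomeomorph M (EuclideanSpace ℝ (Fin n))}

/-- The field is the image of a constant vector field under the tangent map of `e.symm`, which is
smooth. -/
theorem contMDiffOn_chart_frame [IsManifold (𝓡 n) ∞ M]
    (he : e ∈ IsManifold.maximalAtlas (𝓡 n) ∞ M)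
    (v : EuclideanSpace ℝ (Fin n)) :
    ContMDiffOn 𝓘(ℝ, EuclideanSpace ℝ (Fin n)) (𝓡 n).tangent ∞
      (fun y => (⟨e.symm y, mfderiv 𝓘(ℝ, EuclideanSpace ℝ (Fin n)) (𝓡 n) e.symm y v⟩ :
        TangentBundle (𝓡 n) M)) e.target := by
  have : IsManifold (𝓡 n) 1 M := IsManifold.of_le (n := ∞) (by simp)
  have hs := contMDiffOn_symm_of_mem_maximalAtlas he
  have ht := hs.contMDiffOn_tangentMapWithin (m := ∞) (by simp) e.open_target.uniqueMDiffOn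
  have hv : ContMDiffOn 𝓘(ℝ, EuclideanSpace ℝ (Fin n)) (𝓡 n).tangent ∞
      (fun y => (⟨y, v⟩ : TangentBundle 𝓘(ℝ, EuclideanSpace ℝ (Fin n))
        (EuclideanSpace ℝ (Fin n)))) e.target :=
    contMDiffOn_vectorSpace_iff_contDiffOn.2 contDiffOn_const
  refine (ht.comp hv fun y hy => hy).congr fun y hy => ?_
  simp only [Function.comp, tangentMapWithin]
  rw [mfderivWithin_of_isOpen e.open_target hy]

theorem injective_mfderiv_chart_symm (he : e ∈ IsManifold.maximalAtlas (𝓡 n) ∞ M)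
    {x : EuclideanSpace ℝ (Fin n)} (hx : x ∈ e.target) :
    Function.Injective (mfderiv 𝓘(ℝ, EuclideanSpace ℝ (Fin n)) (𝓡 n) e.symm x) := by
  have h : e.MDifferentiable (𝓡 n) 𝓘(ℝ, EuclideanSpace ℝ (Fin n)) :=
    ⟨(contMDiffOn_of_mem_maximalAtlas he).mdifferentiableOn (by simp),
      (contMDiffOn_symm_of_mem_maximalAtlas he).mdifferentiableOn (by simp)⟩
  exact h.symm.mfderiv_injective hx

theorem contDiffOn_comp_chart_symm (he : e ∈ IsManifold.maximalAtlas (𝓡 n) ∞ M) {f : M → ℝ}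
    (hf : ContMDiff (𝓡 n) 𝓘(ℝ, ℝ) ∞ f) : ContDiffOn ℝ ∞ (f ∘ e.symm) e.target :=
  contMDiffOn_iff_contDiffOn.1 (hf.comp_contMDiffOn (contMDiffOn_symm_of_mem_maximalAtlas he))

variable [IsManifold (𝓡 n) ∞ M]
  (g : Bundle.ContMDiffRiemannianMetric (𝓡 n) ∞ (EuclideanSpace ℝ (Fin n))
      (fun p : M => TangentSpace (𝓡 n) p))

theorem smoothEntries_chartMetric (he : e ∈ IsManifold.maximalAtlas (𝓡 n) ∞ M) :
    SmoothEntries (chartMetric g e) e.target := by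
  intro i j
  have hb := g.contMDiff.comp_contMDiffOn (contMDiffOn_symm_of_mem_maximalAtlas he)
  have h : ContMDiffOn 𝓘(ℝ, EuclideanSpace ℝ (Fin n)) ((𝓡 n).prod 𝓘(ℝ, ℝ)) ∞
      (fun y => Bundle.TotalSpace.mk' ℝ (E := Bundle.Trivial M ℝ) (e.symm y)
        (chartMetric g e y i j)) e.target :=
    ContMDiffOn.clm_bundle_apply₂ (F₁ := EuclideanSpace ℝ (Fin n))
      (F₂ := EuclideanSpace ℝ (Fin n)) hb (contMDiffOn_chart_frame he _)
      (contMDiffOn_chart_frame he _)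
  intro y hy
  have h1 := h y hy
  simp only [Bundle.contMDiffWithinAt_totalSpace] at h1
  exact h1.2.contDiffWithinAt

/-- A kernel vector of the Gram matrix gives `v` with `g(Dv, Dv) = 0`; positivity forces `Dv = 0`,
and injectivity of `D` forces `v = 0`. -/
theorem isUnit_det_chartMetric (he : e ∈ IsManifold.maximalAtlas (𝓡 n) ∞ M)
    {x : EuclideanSpace ℝ (Fin n)} (hx : x ∈ e.target) : IsUnit (chartMetric g e x).det := by
  rw [← Matrix.isUnit_iff_isUnit_det, ← Matrix.mulVec_injective_iff_isUnit]
  refine (injective_iff_map_eq_zero (chartMetric g e x).mulVecLin).2 fun c hc => ?_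
  set D := mfderiv 𝓘(ℝ, EuclideanSpace ℝ (Fin n)) (𝓡 n) e.symm x with hD
  set v : EuclideanSpace ℝ (Fin n) := ∑ i, c i • EuclideanSpace.single i (1 : ℝ) with hv
  have hz : g.inner (e.symm x) (D v) (D v) = c ⬝ᵥ (chartMetric g e x).mulVec c := by
    refine (apply_sum_smul_sum_smul D (g.inner (e.symm x)) c _).trans ?_
    simp only [dotProduct, Matrix.mulVec, chartMetric, Matrix.of_apply, Finset.mul_sum, hD]
  have hDv : D v = 0 := by
    by_contra h0
    have := g.pos (e.symm x) (D v) h0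
    rw [hz] at this
    change (chartMetric g e x).mulVec c = 0 at hc
    simp [hc] at this
  have hv0 : v = 0 := injective_mfderiv_chart_symm he hx (hDv.trans (map_zero D).symm)
  funext i
  have := congrArg (fun w : EuclideanSpace ℝ (Fin n) => w i) hv0
  simpa [hv, Finset.sum_apply, Pi.single_apply] using this

theorem isMetricOn_chartMetric (he : e ∈ IsManifold.maximalAtlas (𝓡 n) ∞ M) :
    IsMetricOn (chartMetric g e) e.target where
  isOpen := e.open_target
  smooth := smoothEntries_chartMetric g he
  symm y := by
    ext i j
    exact g.symm _ _ _
  isUnit_det _ hy := isUnit_det_chartMetric g he hy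

end Charts

end SMMS

end

/-! ### Assembly in an arbitrary chart. -/

theorem theorem6p10 {n : ℕ} {M : Type*} [TopologicalSpace M]
    [ChartedSpace (EuclideanSpace ℝ (Fin n)) M] [IsManifold (𝓡 n) ∞ M]
    (g : Bundle.ContMDiffRiemannianMetric (𝓡 n) ∞ (EuclideanSpace ℝ (Fin n))
      (fun p : M => TangentSpace (𝓡 n) p))
    (m : EReal) (hm₁ : m ≠ ((1 - n : ℝ) : EReal)) (hm₂ : m ≠ ((2 - n : ℝ) : EReal)) (μ : ℝ)
    (f : M → ℝ) (hf : ContMDiff (𝓡 n) 𝓘(ℝ, ℝ) ∞ f) (hscale : SMMS.AdmitsScale g m μ f) :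
    ∀ e ∈ IsManifold.maximalAtlas (𝓡 n) ∞ M, ∀ x ∈ e.target, ∀ j k l : Fin n,
      SMMS.div4 (SMMS.chartMetric g e) (SMMS.weightedWeyl (SMMS.chartMetric g e) m μ) j k l x
        = SMMS.divFactor n m *
          SMMS.contractGrad (SMMS.chartMetric g e) (f ∘ e.symm)
            (SMMS.weightedWeyl (SMMS.chartMetric g e) m μ) j k l x := by
  intro e he x hx j k l
  have hG := SMMS.isMetricOn_chartMetric g he
  have hF := SMMS.contDiffOn_comp_chart_symm he hf
  by_cases hm : m = ⊤ ∨ m = ⊥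
  · have hA : SMMS.weightedWeyl (SMMS.chartMetric g e) m μ
        = SMMS.riemann (SMMS.chartMetric g e) := by
      funext i j k l y
      simp [SMMS.weightedWeyl, SMMS.kulkarniNomizu, SMMS.weightedSchouten, hm]
    rw [SMMS.AdmitsScale, if_pos hm] at hscale
    rw [hA, SMMS.divFactor, if_pos hm, SMMS.div4_riemann_of_ricci_eq (a := 0) (μ := μ) hG hx hF]
    · ring
    · intro y hy i j
      linarith [hscale e he y hy i j]
  · obtain ⟨r, rfl⟩ : ∃ r : ℝ, m = r := by
      rw [not_or] at hm
      exact ⟨m.toReal, (EReal.coe_toReal hm.1 hm.2).symm⟩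
    -- The two excluded values of `m` are exactly those where `τ` or `τ + 1`, the denominators in
    -- `P`, vanish.
    have hτ0 : r + n - 2 ≠ 0 := fun h => hm₂ (by rw [show r = 2 - n by linarith])
    have hτ1 : r + n - 2 + 1 ≠ 0 := fun h => hm₁ (by rw [show r = 1 - n by linarith])
    rw [SMMS.AdmitsScale, if_neg hm] at hscale
    obtain ⟨lam, hq⟩ := hscale
    replace hq := hq e he
    rw [SMMS.divFactor, if_neg hm, EReal.toReal_coe,
      SMMS.div4_weightedWeyl hG hx hF rfl hτ0 hτ1
        (fun y hy => (hq y hy).ricci_eq hG hF hy rfl hτ0)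
        (SMMS.pd_scalar_of_QESystem hG hF hx rfl hτ0 hq)]
    congr 2
    ring
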